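/- **Conventions.** A graph $E=(E^0,E^1,r,s)$ consists of countable sets $E^0$ (vertices) and $E^1$ (edges) and maps $r,s:E^1\to E^0$ (range and source). Let $R\neq 0$ be a commutative ring with $1$. The Leavitt path algebra $L_R(E)$ is the universal (not necessarily unital) associative $R$-algebra generated by elements $v$, $e$, $e^*$ ($v\in E^0$, $e\in E^1$) such that the $v$ are pairwise orthogonal idempotents, $s(e)e=er(e)=e$, $r(e)e^*=e^*s(e)=e^*$, $e^*f=\delta_{e,f}r(e)$ for $e,f\in E^1$, and $v=\sum_{s(e)=v}ee^*$ whenever $0<|s^{-1}(v)|<\infty$. A path is a vertex (length $0$) or a word $\alpha=e_1\cdots e_n$, $n\ge 1$, with $r(e_i)=s(e_{i+1})$ for $1\le i<n$; then $|\alpha|=n$, $s(\alpha)=s(e_1)$, $r(\alpha)=r(e_n)$ and $\alpha^*=e_n^*\cdots e_1^*$ (and $v^*=v$ for a vertex $v$). The algebra is $\mathbb Z$-graded by $L_R(E)_k=\operatorname{span}_R\{\alpha\beta^*: \alpha,\beta \text{ paths},\ |\alpha|-|\beta|=k\}$. Ideals are two-sided, and an ideal $I$ is *graded* if $I=\bigoplus_{k\in\mathbb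 Z}(I\cap L_R(E)_k)$. An ideal $I$ of $L_R(E)$ is *basic* if, for every $r\in R\setminus\{0\}$, $rx\in I$ implies $x\in I$ whenever $x=v$ or $x=v-\sum_{i=1}^n e_ie_i^*$ with $v\in E^0$ and $e_1,\dots,e_n$ distinct edges with source $v$. A closed path based at $v$ is a path $\alpha$ of positive length with $s(\alpha)=r(\alpha)=v$; it is a closed simple path if, moreover, $\alpha=e_1\cdots e_n$ with $s(e_i)\ne s(e_1)$ for all $i>1$. The graph $E$ satisfies *Condition (K)* if every vertex is either the base of no closed path or the base of at least two distinct closed simple paths. A set $H\subseteq E^0$ is *hereditary* if $s(e)\in H$ implies $r(e)\in H$, and *saturated* if $v\in H$ whenever $0<|s^{-1}(v)|<\infty$ and $r(e)\in H$ for all $e\in s^{-1}(v)$. For a saturated hereditary set $H$ let $B_H=\{v\in E^0\setminus H:|s^{-1}(v)|=\infty,\ 0<|s^{-1}(v)\cap r^{-1}(E^0\setminus H)|<\infty\}$ and, for $v\in B_H$, $v^H=v-\sum_{s(e)=v,\,r(e)\notin H}ee^*$. An *admissible pair* is a pair $(H,S)$ with $H$ saturated hereditary and $S\subseteq B_H$;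 let $I(H,S)$ be the ideal of $L_R(E)$ generated by $\{v:v\in H\}\cup\{v^H:v\in S\}$. **Theorem.** Let $E$ be a graph and $R$ a nonzero commutative ring with $1$. 1. $E$ satisfies Condition (K) if and only if every basic ideal of $L_R(E)$ is graded. 2. If $E$ satisfies Condition (K), then $(H,S)\mapsto I(H,S)$ is a bijection from the set of admissible pairs in $E$ onto the set of basic ideals of $L_R(E)$. -/

import Mathlib

/-! ### Directed graphs, paths, Condition (K) -/

/-- A directed graph `E = (E⁰, E¹, r, s)` with vertex set `V` and edge set `A`
(parallel edges and loops allowed). -/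
structure DirectedGraph (V : Type*) (A : Type*) where
  /-- the source map `s` -/
  source : A → V
  /-- the range map `r` -/
  range : A → V

namespace DirectedGraph

/-- The set `s⁻¹(v)` of edges emitted by `v`. -/
def emitted {V A : Type*} (G : DirectedGraph V A) (v : V) : Set A :=
  {e | G.source e = v}

/-- The list of edges `e₁, …, eₙ` can be traversed in this order starting from `v`:
`s(e₁) = v` and `r(eᵢ) = s(eᵢ₊₁)`. -/
def IsWalkFrom {V A : Type*} (G : DirectedGraph V A) : V → List A → Prop
  | _, [] => True
  | v, e :: l => G.source e = v ∧ G.IsWalkFrom (G.range e) l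

/-- The vertex reached from `v` after traversing a list of edges. -/
def endOf {V A : Type*} (G : DirectedGraph V A) : V → List A → V
  | v, [] => v
  | _, e :: l => G.endOf (G.range e) l

/-- Finite paths; the paths of length zero are the vertices. -/
@[ext]
structure Path {V A : Type*} (G : DirectedGraph V A) where
  /-- the source of the path -/
  start : V
  /-- the edges of the path, in the order of traversal -/
  edges : List A
  isWalk : G.IsWalkFrom start edges

/-- The range of a path. -/
def Path.finish {V A : Type*} {G : DirectedGraph V A} (α : G.Path) : V :=
  G.endOf α.start α.edges

/-- The length of a path. -/
def Path.length {V A : Type*} {G : DirectedGraph V A} (α : G.Path) : ℕ :=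
  α.edges.length

/-- `α` is a closed path based at `v`: it has positive length and source and range `v`. -/
def Path.IsClosedAt {V A : Type*} {G : DirectedGraph V A} (α : G.Path) (v : V) : Prop :=
  0 < α.length ∧ α.start = v ∧ α.finish = v

/-- `α = e₁ ⋯ eₙ` is a closed simple path based at `v`: a closed path based at `v`
with `s(eᵢ) ≠ s(e₁)` for all `i > 1`. -/
def Path.IsClosedSimpleAt {V A : Type*} {G : DirectedGraph V A} (α : G.Path) (v : V) : Prop :=
  α.IsClosedAt v ∧ ∀ e ∈ α.edges.tail, G.source e ≠ v

/-- Condition (K): every vertex is either the base of no closed path or the base of at least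
two distinct closed simple paths. -/
def ConditionK {V A : Type*} (G : DirectedGraph V A) : Prop :=
  ∀ v : V, (¬ ∃ α : G.Path, α.IsClosedAt v) ∨
    ∃ α β : G.Path, α ≠ β ∧ α.IsClosedSimpleAt v ∧ β.IsClosedSimpleAt v

/-! ### Admissible pairs -/

/-- `X` is hereditary: `s(e) ∈ X` implies `r(e) ∈ X`. -/
def Hereditary {V A : Type*} (G : DirectedGraph V A) (X : Set V) : Prop :=
  ∀ e : A, G.source e ∈ X → G.range e ∈ X

/-- `X` is saturated: a vertex which emits at least one and only finitely many edges, all of them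
with range in `X`, belongs to `X`. -/
def Saturated {V A : Type*} (G : DirectedGraph V A) (X : Set V) : Prop :=
  ∀ v : V, (G.emitted v).Nonempty → (G.emitted v).Finite →
    (∀ e ∈ G.emitted v, G.range e ∈ X) → v ∈ X

/-- The set `s⁻¹(v) ∩ r⁻¹(E⁰ \ H)`. -/
def emittedOutside {V A : Type*} (G : DirectedGraph V A) (H : Set V) (v : V) : Set A :=
  {e | G.source e = v ∧ G.range e ∉ H}

/-- The set `B_H` of breaking vertices of `H`: the vertices outside `H` which emit infinitely many
edges, of which at least one and only finitely many have range outside `H`. -/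
def breaking {V A : Type*} (G : DirectedGraph V A) (H : Set V) : Set V :=
  {v | v ∉ H ∧ (G.emitted v).Infinite ∧
    (G.emittedOutside H v).Nonempty ∧ (G.emittedOutside H v).Finite}

/-- Admissible pairs `(H, S)`: `H` is a saturated hereditary set of vertices and `S ⊆ B_H`. -/
@[ext]
structure AdmissiblePair {V A : Type*} (G : DirectedGraph V A) where
  H : Set V
  S : Set V
  hereditary : G.Hereditary H
  saturated : G.Saturated H
  subset_breaking : S ⊆ G.breaking H

end DirectedGraph

/-! ### Leavitt families and the Leavitt path algebra -/

/-- `a_v`, `b_e`, `c_e` (for `v`, `e`, `e*`) form a Leavitt family of the graph `G` in the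
(not necessarily unital) ring `B`. -/
structure IsLeavittFamily {V A B : Type*} [NonUnitalRing B] (G : DirectedGraph V A)
    (a : V → B) (b c : A → B) : Prop where
  idempotent : ∀ v, a v * a v = a v
  orthogonal : ∀ v w, v ≠ w → a v * a w = 0
  source_mul : ∀ e, a (G.source e) * b e = b e
  mul_range : ∀ e, b e * a (G.range e) = b e
  range_mul : ∀ e, a (G.range e) * c e = c e
  mul_source : ∀ e, c e * a (G.source e) = c e
  ghost_mul_self : ∀ e, c e * b e = a (G.range e)
  ghost_mul_ne : ∀ e f, e ≠ f → c e * b f = 0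
  vertex_eq_sum : ∀ v, (G.emitted v).Nonempty → ∀ h : (G.emitted v).Finite,
    a v = ∑ e ∈ h.toFinset, b e * c e

/-- The formal generators `v`, `e`, `e*`. -/
inductive LeavittGen (V A : Type*) where
  | vertex : V → LeavittGen V A
  | edge : A → LeavittGen V A
  | ghost : A → LeavittGen V A

/-- The free associative (non-unital) `R`-algebra on the symbols `v`, `e`, `e*`. -/
abbrev LeavittFree (R V A : Type*) [CommRing R] : Type _ :=
  MonoidAlgebra R (FreeSemigroup (LeavittGen V A))

/-- A generator as an element of the free algebra. -/
noncomputable def LeavittFree.of (R : Type*) {V A : Type*} [CommRing R] (x : LeavittGen V A) :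
    LeavittFree R V A :=
  MonoidAlgebra.single (FreeSemigroup.of x) 1

open LeavittFree LeavittGen in
/-- The defining relations of the Leavitt path algebra. -/
inductive LeavittRel (R : Type*) {V A : Type*} [CommRing R] (G : DirectedGraph V A) :
    LeavittFree R V A → LeavittFree R V A → Prop
  | idempotent (v : V) : LeavittRel R G (of R (vertex v) * of R (vertex v)) (of R (vertex v))
  | orthogonal (v w : V) : v ≠ w → LeavittRel R G (of R (vertex v) * of R (vertex w)) 0
  | source_mul (e : A) :
      LeavittRel R G (of R (vertex (G.source e)) * of R (edge e)) (of R (edge e))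
  | mul_range (e : A) :
      LeavittRel R G (of R (edge e) * of R (vertex (G.range e))) (of R (edge e))
  | range_mul (e : A) :
      LeavittRel R G (of R (vertex (G.range e)) * of R (ghost e)) (of R (ghost e))
  | mul_source (e : A) :
      LeavittRel R G (of R (ghost e) * of R (vertex (G.source e))) (of R (ghost e))
  | ghost_mul_self (e : A) :
      LeavittRel R G (of R (ghost e) * of R (edge e)) (of R (vertex (G.range e)))
  | ghost_mul_ne (e f : A) : e ≠ f → LeavittRel R G (of R (ghost e) * of R (edge f)) 0
  | vertex_eq_sum (v : V) (_ : (G.emitted v).Nonempty) (h : (G.emitted v).Finite) :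
      LeavittRel R G (of R (vertex v)) (∑ e ∈ h.toFinset, of R (edge e) * of R (ghost e))

/-- The congruence generated by all scalar multiples of the defining relations
(the free algebra has no unit, so scalar multiples have to be put in). -/
noncomputable def leavittCon (R : Type*) {V A : Type*} [CommRing R] (G : DirectedGraph V A) :
    RingCon (LeavittFree R V A) :=
  ringConGen fun x y => ∃ (r : R) (a b : LeavittFree R V A),
    LeavittRel R G a b ∧ x = r • a ∧ y = r • b

theorem leavittCon_smul (R : Type*) {V A : Type*} [CommRing R] (G : DirectedGraph V A) (r : R)
    {x y : LeavittFree R V A} (h : leavittCon R G x y) : leavittCon R G (r • x) (r • y) := by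
  change RingConGen.Rel _ _ _ at h
  change RingConGen.Rel _ _ _
  induction h with
  | of x y h =>
    obtain ⟨t, a, b, hab, rfl, rfl⟩ := h
    exact .of _ _ ⟨r * t, a, b, hab, by rw [mul_smul], by rw [mul_smul]⟩
  | refl x => exact .refl _
  | symm _ ih => exact .symm ih
  | trans _ _ ih₁ ih₂ => exact .trans ih₁ ih₂
  | add _ _ ih₁ ih₂ => rw [smul_add, smul_add]; exact .add ih₁ ih₂
  | mul _ h₂ ih₁ _ => rw [← smul_mul_assoc, ← smul_mul_assoc]; exact .mul ih₁ h₂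

/-- The Leavitt path algebra `L_R(E)`: the universal (not necessarily unital) `R`-algebra generated
by a Leavitt `E`-family. -/
noncomputable def LeavittPathAlgebra (R : Type*) {V A : Type*} [CommRing R] (G : DirectedGraph V A) : Type _ :=
  (leavittCon R G).Quotient

namespace LeavittPathAlgebra

noncomputable instance {R V A : Type*} [CommRing R] {G : DirectedGraph V A} :
    NonUnitalRing (LeavittPathAlgebra R G) :=
  inferInstanceAs (NonUnitalRing (leavittCon R G).Quotient)

/-- The quotient map from the free algebra. -/
noncomputable def mk (R : Type*) {V A : Type*} [CommRing R] (G : DirectedGraph V A) (x : LeavittFree R V A) :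
    LeavittPathAlgebra R G :=
  RingCon.toQuotient (c := leavittCon R G) x

theorem mk_surjective {R V A : Type*} [CommRing R] {G : DirectedGraph V A} :
    Function.Surjective (mk R G) :=
  Quotient.mk''_surjective

noncomputable instance {R V A : Type*} [CommRing R] {G : DirectedGraph V A} :
    SMul R (LeavittPathAlgebra R G) where
  smul r := Quotient.map' (r • ·) fun _ _ h => leavittCon_smul R G r h

noncomputable instance {R V A : Type*} [CommRing R] {G : DirectedGraph V A} :
    Module R (LeavittPathAlgebra R G) :=
  Function.Surjective.module R
    { toFun := mk R G, map_zero' := rfl, map_add' := fun _ _ => rfl } mk_surjective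
    (fun _ _ => rfl)

noncomputable instance {R V A : Type*} [CommRing R] {G : DirectedGraph V A} :
    IsScalarTower R (LeavittPathAlgebra R G) (LeavittPathAlgebra R G) where
  smul_assoc r x y := by
    obtain ⟨x, rfl⟩ := mk_surjective x
    obtain ⟨y, rfl⟩ := mk_surjective y
    exact congrArg (mk R G) (smul_mul_assoc r x y)

noncomputable instance {R V A : Type*} [CommRing R] {G : DirectedGraph V A} :
    SMulCommClass R (LeavittPathAlgebra R G) (LeavittPathAlgebra R G) where
  smul_comm r x y := by
    obtain ⟨x, rfl⟩ := mk_surjective x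
    obtain ⟨y, rfl⟩ := mk_surjective y
    exact congrArg (mk R G) (mul_smul_comm r x y).symm

/-- The quotient map as a homomorphism of algebras. -/
noncomputable def mkHom (R : Type*) {V A : Type*} [CommRing R] (G : DirectedGraph V A) :
    LeavittFree R V A →ₙₐ[R] LeavittPathAlgebra R G where
  toFun := mk R G
  map_smul' _ _ := rfl
  map_zero' := rfl
  map_add' _ _ := rfl
  map_mul' _ _ := rfl

/-- The element `v` of `L_R(E)`. -/
noncomputable def vertex (R : Type*) {V A : Type*} [CommRing R] (G : DirectedGraph V A) (v : V) :
    LeavittPathAlgebra R G :=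
  mkHom R G (LeavittFree.of R (.vertex v))

/-- The element `e` of `L_R(E)`. -/
noncomputable def edge (R : Type*) {V A : Type*} [CommRing R] (G : DirectedGraph V A) (e : A) :
    LeavittPathAlgebra R G :=
  mkHom R G (LeavittFree.of R (.edge e))

/-- The element `e*` of `L_R(E)`. -/
noncomputable def ghost (R : Type*) {V A : Type*} [CommRing R] (G : DirectedGraph V A) (e : A) :
    LeavittPathAlgebra R G :=
  mkHom R G (LeavittFree.of R (.ghost e))

theorem mkHom_eq_of_rel {R V A : Type*} [CommRing R] {G : DirectedGraph V A}
    {x y : LeavittFree R V A} (h : LeavittRel R G x y) : mkHom R G x = mkHom R G y :=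
  Quotient.sound' (RingConGen.Rel.of _ _ ⟨1, x, y, h, (one_smul R x).symm, (one_smul R y).symm⟩)

/-- The generators of `L_R(E)` form a Leavitt family. -/
theorem isLeavittFamily (R : Type*) {V A : Type*} [CommRing R] (G : DirectedGraph V A) :
    IsLeavittFamily G (vertex R G) (edge R G) (ghost R G) where
  idempotent v := by
    simpa only [map_mul] using! mkHom_eq_of_rel (LeavittRel.idempotent (R := R) (G := G) v)
  orthogonal v w h := by
    simpa only [map_mul, map_zero] using!
      mkHom_eq_of_rel (LeavittRel.orthogonal (R := R) (G := G) v w h)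
  source_mul e := by
    simpa only [map_mul] using! mkHom_eq_of_rel (LeavittRel.source_mul (R := R) (G := G) e)
  mul_range e := by
    simpa only [map_mul] using! mkHom_eq_of_rel (LeavittRel.mul_range (R := R) (G := G) e)
  range_mul e := by
    simpa only [map_mul] using! mkHom_eq_of_rel (LeavittRel.range_mul (R := R) (G := G) e)
  mul_source e := by
    simpa only [map_mul] using! mkHom_eq_of_rel (LeavittRel.mul_source (R := R) (G := G) e)
  ghost_mul_self e := by
    simpa only [map_mul] using! mkHom_eq_of_rel (LeavittRel.ghost_mul_self (R := R) (G := G) e)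
  ghost_mul_ne e f h := by
    simpa only [map_mul, map_zero] using!
      mkHom_eq_of_rel (LeavittRel.ghost_mul_ne (R := R) (G := G) e f h)
  vertex_eq_sum v h₁ h₂ := by
    simpa only [map_mul, map_sum] using!
      mkHom_eq_of_rel (LeavittRel.vertex_eq_sum (R := R) (G := G) v h₁ h₂)

/-- The universal property of `L_R(E)`. -/
theorem existsUnique_lift {R V A B : Type*} [CommRing R] {G : DirectedGraph V A}
    [NonUnitalRing B] [Module R B] [IsScalarTower R B B] [SMulCommClass R B B]
    {a : V → B} {b c : A → B} (h : IsLeavittFamily G a b c) :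
    ∃! φ : LeavittPathAlgebra R G →ₙₐ[R] B,
      (∀ v, φ (vertex R G v) = a v) ∧ (∀ e, φ (edge R G e) = b e) ∧
        ∀ e, φ (ghost R G e) = c e := by
  let g : LeavittGen V A → B := fun x => match x with
    | .vertex v => a v
    | .edge e => b e
    | .ghost e => c e
  let ψ : LeavittFree R V A →ₙₐ[R] B := MonoidAlgebra.liftMagma R (FreeSemigroup.lift g)
  have hψ : ∀ x, ψ (LeavittFree.of R x) = g x := fun x => by
    simp [ψ, LeavittFree.of]
  have hrel : ∀ x y, LeavittRel R G x y → ψ x = ψ y := by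
    intro x y hxy
    cases hxy with
    | idempotent v => simpa only [map_mul, hψ] using h.idempotent v
    | orthogonal v w hne => simpa only [map_mul, map_zero, hψ] using h.orthogonal v w hne
    | source_mul e => simpa only [map_mul, hψ] using h.source_mul e
    | mul_range e => simpa only [map_mul, hψ] using h.mul_range e
    | range_mul e => simpa only [map_mul, hψ] using h.range_mul e
    | mul_source e => simpa only [map_mul, hψ] using h.mul_source e
    | ghost_mul_self e => simpa only [map_mul, hψ] using h.ghost_mul_self e
    | ghost_mul_ne e f hne => simpa only [map_mul, map_zero, hψ] using h.ghost_mul_ne e f hne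
    | vertex_eq_sum v h₁ h₂ =>
      simpa only [map_mul, map_sum, hψ] using h.vertex_eq_sum v h₁ h₂
  have hcon : ∀ x y, leavittCon R G x y → ψ x = ψ y := by
    intro x y hxy
    change RingConGen.Rel _ _ _ at hxy
    induction hxy with
    | of x y h =>
      obtain ⟨t, a, b, hab, rfl, rfl⟩ := h
      rw [map_smul, map_smul, hrel _ _ hab]
    | refl x => rfl
    | symm _ ih => exact ih.symm
    | trans _ _ ih₁ ih₂ => exact ih₁.trans ih₂
    | add _ _ ih₁ ih₂ => rw [map_add, map_add, ih₁, ih₂]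
    | mul _ _ ih₁ ih₂ => rw [map_mul, map_mul, ih₁, ih₂]
  let φ : LeavittPathAlgebra R G →ₙₐ[R] B :=
    { toFun := fun x => Quotient.liftOn' x ψ hcon
      map_smul' := fun r x => by
        obtain ⟨x, rfl⟩ := mk_surjective x
        exact map_smul ψ r x
      map_zero' := map_zero ψ
      map_add' := fun x y => by
        obtain ⟨x, rfl⟩ := mk_surjective x
        obtain ⟨y, rfl⟩ := mk_surjective y
        exact map_add ψ x y
      map_mul' := fun x y => by
        obtain ⟨x, rfl⟩ := mk_surjective x
        obtain ⟨y, rfl⟩ := mk_surjective y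
        exact map_mul ψ x y }
  refine ⟨φ, ⟨fun v => hψ _, fun e => hψ _, fun e => hψ _⟩, ?_⟩
  rintro φ' ⟨h₁, h₂, h₃⟩
  have key : φ'.comp (mkHom R G) = φ.comp (mkHom R G) := by
    apply (MonoidAlgebra.liftMagma R).symm.injective
    apply FreeSemigroup.lift.symm.injective
    funext x
    change φ' (mkHom R G (LeavittFree.of R x)) = ψ (LeavittFree.of R x)
    rw [hψ]
    cases x with
    | vertex v => exact h₁ v
    | edge e => exact h₂ e
    | ghost e => exact h₃ e
  ext x
  obtain ⟨x, rfl⟩ := mk_surjective x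
  exact DFunLike.congr_fun key x

/-! ### The grading, basic ideals, and the ideals `I(H, S)` -/

/-- The product `e₁ ⋯ eₙ r(eₙ)` for the list of edges `e₁, …, eₙ`; it is `v` for the empty list. -/
noncomputable def pathProd (R : Type*) {V A : Type*} [CommRing R] (G : DirectedGraph V A) :
    V → List A → LeavittPathAlgebra R G
  | v, [] => vertex R G v
  | _, e :: l => edge R G e * pathProd R G (G.range e) l

/-- The product `r(eₙ) eₙ* ⋯ e₁*` for the list of edges `e₁, …, eₙ`; it is `v` for the empty
list. -/
noncomputable def ghostProd (R : Type*) {V A : Type*} [CommRing R] (G : DirectedGraph V A) :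
    V → List A → LeavittPathAlgebra R G
  | v, [] => vertex R G v
  | _, e :: l => ghostProd R G (G.range e) l * ghost R G e

/-- The element `α` of `L_R(E)` given by a path `α`. -/
noncomputable def ofPath (R : Type*) {V A : Type*} [CommRing R] {G : DirectedGraph V A}
    (α : G.Path) : LeavittPathAlgebra R G :=
  pathProd R G α.start α.edges

/-- The element `α*` of `L_R(E)` given by a path `α`. -/
noncomputable def ofPathStar (R : Type*) {V A : Type*} [CommRing R] {G : DirectedGraph V A}
    (α : G.Path) : LeavittPathAlgebra R G :=
  ghostProd R G α.start α.edges

/-- The homogeneous component of degree `k`: the `R`-span of all `αβ*` with `|α| - |β| = k`. -/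
noncomputable def component (R : Type*) {V A : Type*} [CommRing R] (G : DirectedGraph V A) (k : ℤ) :
    Submodule R (LeavittPathAlgebra R G) :=
  Submodule.span R {x | ∃ α β : G.Path, (α.length : ℤ) - (β.length : ℤ) = k ∧
    x = ofPath R α * ofPathStar R β}

/-- The additive group `I ∩ L_R(E)_k`. -/
noncomputable def idealComponent {R V A : Type*} [CommRing R] {G : DirectedGraph V A}
    (I : TwoSidedIdeal (LeavittPathAlgebra R G)) (k : ℤ) : AddSubgroup (LeavittPathAlgebra R G) :=
  AddSubgroup.ofClass I ⊓ (component R G k).toAddSubgroup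

/-- A two-sided ideal `I` is graded: it is the internal direct sum of the groups
`I ∩ L_R(E)_k`, `k ∈ ℤ`. -/
def IsGradedIdeal {R V A : Type*} [CommRing R] {G : DirectedGraph V A}
    (I : TwoSidedIdeal (LeavittPathAlgebra R G)) : Prop :=
  iSupIndep (idealComponent I) ∧ ⨆ k : ℤ, idealComponent I k = AddSubgroup.ofClass I

/-- A two-sided ideal `I` is basic: if `r ≠ 0` and `r x ∈ I`, then `x ∈ I`, where `x` is a vertex or
`x = v - ∑ eᵢeᵢ*` for finitely many distinct edges `eᵢ` emitted by the vertex `v`. -/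
def IsBasicIdeal {R V A : Type*} [CommRing R] {G : DirectedGraph V A}
    (I : TwoSidedIdeal (LeavittPathAlgebra R G)) : Prop :=
  (∀ (r : R) (v : V), r ≠ 0 → r • vertex R G v ∈ I → vertex R G v ∈ I) ∧
  ∀ (r : R) (v : V) (F : Finset A), r ≠ 0 → (∀ e ∈ F, G.source e = v) →
    r • (vertex R G v - ∑ e ∈ F, edge R G e * ghost R G e) ∈ I →
      vertex R G v - ∑ e ∈ F, edge R G e * ghost R G e ∈ I

/-- For `v ∈ B_H`, the element `v^H = v - ∑ ee*`, where the (finite) sum is over the edges `e` with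
`s(e) = v` and `r(e) ∉ H`. -/
noncomputable def breakingElement (R : Type*) {V A : Type*} [CommRing R] (G : DirectedGraph V A)
    (H : Set V) (v : V) (hv : v ∈ G.breaking H) : LeavittPathAlgebra R G :=
  vertex R G v - ∑ e ∈ hv.2.2.2.toFinset, edge R G e * ghost R G e

/-- The ideal `I(H, S)` generated by `{v : v ∈ H} ∪ {v^H : v ∈ S}`. -/
noncomputable def idealOfPair (R : Type*) {V A : Type*} [CommRing R] {G : DirectedGraph V A}
    (P : G.AdmissiblePair) : TwoSidedIdeal (LeavittPathAlgebra R G) :=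
  TwoSidedIdeal.span
    ({x | ∃ v ∈ P.H, x = vertex R G v} ∪
      {x | ∃ (v : V) (hv : v ∈ P.S), x = breakingElement R G P.H v (P.subset_breaking hv)})

end LeavittPathAlgebra

/-! Non-membership in ideals is detected by representations on functions `X → R`. In the
representation of a branching system, v acts as the indicator of `D v`, and v - ∑ ee* as the
indicator of the part of `D v` not covered by the images of the chosen edges. A nonzero scalar kills
an indicator only if the set is empty, so the kernel of such a representation is always basic
(`isBasicIdeal_ker`).

For an admissible pair (H, S), a system on V × ℕ has a fibre over each v ∉ H, covered by the edges
from v with range outside H exactly when v is regular for the pair. Its kernel contains I(H, S).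
Hence I(H, S) contains no vertex outside H and no v^H with v ∈ B_H \ S: the pair can be recovered,
and I(H, S) is basic. It is graded because its generators have degree zero.

Assume Condition (K), let I be basic, read (H, S) off from I and put J = I(H, S) ⊆ I. Suppose x ∈ I
\ J. Right multiplication by edges shortens ghost paths until, modulo J, x is p or p(w - ∑ ee*) with
p a combination of paths ending at w. Multiplying by α* for a shortest path α in p leaves rw plus
closed paths at w. Condition (K) gives closed paths d such that y ↦ d*yd fixes rw and removes these
terms one by one; next to a breaking element, the factor w - ∑ ee* kills them by itself. So rq ∈ I
with r ≠ 0 and q a vertex outside H or a v^H with v ∈ B_H \ S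
(`exists_reduced_of_mem_ghostFiltration`). As I is basic, q ∈ I, contrary to the choice of (H, S).

If Condition (K) fails, some vertex u has exactly one closed simple path c. On the walks that stop
at their first visit to u, `D u` is a single point, so u and c act alike. The kernel is basic and
contains u - c but not u, the degree zero part of u - c; so it is not graded. -/

/-! ### Walks -/

namespace DirectedGraph

variable {V A : Type*} {E : DirectedGraph V A}

theorem isWalkFrom_append {v : V} {l m : List A} :
    E.IsWalkFrom v (l ++ m) ↔ E.IsWalkFrom v l ∧ E.IsWalkFrom (E.endOf v l) m := by
  induction l generalizing v with
  | nil => simp [IsWalkFrom, endOf]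
  | cons e l ih => simp [IsWalkFrom, endOf, ih, and_assoc]

theorem endOf_append (v : V) (l m : List A) :
    E.endOf v (l ++ m) = E.endOf (E.endOf v l) m := by
  induction l generalizing v with
  | nil => rfl
  | cons e l ih => simp [endOf, ih]

/-- A hereditary set contains the end of every walk which starts in it. -/
theorem Hereditary.endOf_mem {H : Set V} (hH : E.Hereditary H) {v : V} {l : List A}
    (hl : E.IsWalkFrom v l) (hv : v ∈ H) : E.endOf v l ∈ H := by
  induction l generalizing v with
  | nil => exact hv
  | cons e l ih => exact ih hl.2 (hH e (hl.1.symm ▸ hv))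

/-- A walk which ends at `v` can be cut at its first visit to `v`. -/
theorem exists_walk_avoiding {v w : V} {l : List A} (hl : E.IsWalkFrom w l)
    (he : E.endOf w l = v) :
    ∃ m, E.IsWalkFrom w m ∧ E.endOf w m = v ∧ ∀ e ∈ m, E.source e ≠ v := by
  induction l generalizing w with
  | nil => exact ⟨[], hl, he, by simp⟩
  | cons e l ih =>
    by_cases h : E.source e = v
    · exact ⟨[], trivial, hl.1.symm.trans h, by simp⟩
    · obtain ⟨m, h₁, h₂, h₃⟩ := ih hl.2 he
      exact ⟨e :: m, ⟨hl.1, h₁⟩, h₂, by simpa using ⟨h, h₃⟩⟩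

/-- A proper nonempty prefix of a closed simple path is not closed. -/
theorem Path.IsClosedSimpleAt.eq_of_prefix {v : V} {α : E.Path} (hα : α.IsClosedSimpleAt v)
    {l : List A} (hl : l <+: α.edges) (hne : l ≠ []) (he : E.endOf v l = v) : l = α.edges := by
  obtain ⟨t, ht⟩ := hl
  have hw := α.isWalk
  rw [← ht, hα.1.2.1, isWalkFrom_append, he] at hw
  cases t with
  | nil => simpa using ht
  | cons f t =>
    -- The edge following a closed prefix has source `v`, which the tail of a closed simple path
    -- avoids.
    refine absurd hw.2.1 (hα.2 f ?_)
    cases l with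
    | nil => exact absurd rfl hne
    | cons e l => rw [← ht]; simp

end DirectedGraph

namespace LeavittPathAlgebra

variable {R V A : Type*} [CommRing R] {E : DirectedGraph V A}

/-! ### Generators and products of generators -/

theorem vertex_mul_self (v : V) : vertex R E v * vertex R E v = vertex R E v :=
  (isLeavittFamily R E).idempotent v

theorem vertex_mul_of_ne {v w : V} (h : v ≠ w) : vertex R E v * vertex R E w = 0 :=
  (isLeavittFamily R E).orthogonal v w h

theorem vertex_mul_edge {v : V} {e : A} (h : E.source e = v) :
    vertex R E v * edge R E e = edge R E e :=
  h ▸ (isLeavittFamily R E).source_mul e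

theorem edge_mul_vertex {v : V} {e : A} (h : E.range e = v) :
    edge R E e * vertex R E v = edge R E e :=
  h ▸ (isLeavittFamily R E).mul_range e

theorem vertex_mul_ghost {v : V} {e : A} (h : E.range e = v) :
    vertex R E v * ghost R E e = ghost R E e :=
  h ▸ (isLeavittFamily R E).range_mul e

theorem ghost_mul_vertex {v : V} {e : A} (h : E.source e = v) :
    ghost R E e * vertex R E v = ghost R E e :=
  h ▸ (isLeavittFamily R E).mul_source e

theorem ghost_mul_edge_self (e : A) : ghost R E e * edge R E e = vertex R E (E.range e) :=
  (isLeavittFamily R E).ghost_mul_self e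

theorem ghost_mul_edge_of_ne {e f : A} (h : e ≠ f) : ghost R E e * edge R E f = 0 :=
  (isLeavittFamily R E).ghost_mul_ne e f h

theorem edge_mul_vertex_of_ne {v : V} {e : A} (h : E.range e ≠ v) :
    edge R E e * vertex R E v = 0 := by
  rw [← edge_mul_vertex (R := R) (rfl : E.range e = E.range e), mul_assoc,
    vertex_mul_of_ne h, mul_zero]

theorem ghost_mul_vertex_of_ne {v : V} {e : A} (h : E.source e ≠ v) :
    ghost R E e * vertex R E v = 0 := by
  rw [← ghost_mul_vertex (R := R) (rfl : E.source e = E.source e), mul_assoc,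
    vertex_mul_of_ne h, mul_zero]

theorem vertex_mul_pathProd {v : V} {l : List A} (hl : E.IsWalkFrom v l) :
    vertex R E v * pathProd R E v l = pathProd R E v l := by
  cases l with
  | nil => exact vertex_mul_self v
  | cons e l => rw [pathProd, ← mul_assoc, vertex_mul_edge hl.1]

theorem ghostProd_mul_vertex {v : V} {l : List A} (hl : E.IsWalkFrom v l) :
    ghostProd R E v l * vertex R E v = ghostProd R E v l := by
  cases l with
  | nil => exact vertex_mul_self v
  | cons e l => rw [ghostProd, mul_assoc, ghost_mul_vertex hl.1]

theorem pathProd_append (v : V) (l m : List A) (hm : E.IsWalkFrom (E.endOf v l) m) :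
    pathProd R E v (l ++ m) = pathProd R E v l * pathProd R E (E.endOf v l) m := by
  induction l generalizing v with
  | nil => exact (vertex_mul_pathProd hm).symm
  | cons e l ih => simp only [List.cons_append, pathProd, DirectedGraph.endOf, mul_assoc] at hm ⊢
                   rw [ih _ hm]

theorem pathProd_mul_vertex (v : V) (l : List A) :
    pathProd R E v l * vertex R E (E.endOf v l) = pathProd R E v l := by
  simpa [pathProd] using (pathProd_append (R := R) v l [] trivial).symm

theorem vertex_mul_ghostProd (v : V) (l : List A) :
    vertex R E (E.endOf v l) * ghostProd R E v l = ghostProd R E v l := by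
  induction l generalizing v with
  | nil => exact vertex_mul_self v
  | cons e l ih => rw [ghostProd, ← mul_assoc, DirectedGraph.endOf, ih]

theorem pathProd_mul_edge (v : V) (l : List A) {f : A} (hf : E.source f = E.endOf v l) :
    pathProd R E v l * edge R E f = pathProd R E v (l ++ [f]) := by
  rw [pathProd_append v l [f] ⟨hf, trivial⟩, pathProd, pathProd, edge_mul_vertex rfl]

theorem ghostProd_mul_pathProd_append {v : V} {l m : List A} (h : E.IsWalkFrom v (l ++ m)) :
    ghostProd R E v l * pathProd R E v (l ++ m) = pathProd R E (E.endOf v l) m := by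
  induction l generalizing v with
  | nil => exact vertex_mul_pathProd h
  | cons e l ih =>
    rw [List.cons_append, pathProd, ghostProd, mul_assoc, ← mul_assoc (ghost R E e),
      ghost_mul_edge_self, vertex_mul_pathProd (l := l ++ m) h.2, ih h.2, DirectedGraph.endOf]

theorem ghostProd_mul_pathProd_self {v : V} {l : List A} (h : E.IsWalkFrom v l) :
    ghostProd R E v l * pathProd R E v l = vertex R E (E.endOf v l) := by
  simpa [pathProd] using ghostProd_mul_pathProd_append (R := R) (m := []) (by simpa using h)

theorem ghostProd_mul_pathProd_of_incomparable {v : V} {l m : List A} (hl : ¬ l <+: m)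
    (hm : ¬ m <+: l) : ghostProd R E v l * pathProd R E v m = 0 := by
  induction l generalizing v m with
  | nil => simp at hl
  | cons e l ih =>
    cases m with
    | nil => simp at hm
    | cons f m =>
      rw [pathProd, ghostProd, mul_assoc, ← mul_assoc (ghost R E e)]
      by_cases hef : e = f
      · subst hef
        rw [ghost_mul_edge_self, ← mul_assoc]
        simp only [List.cons_prefix_cons, true_and] at hl hm
        -- The lists need not be walks: the vertex r(e) left in the middle is either absorbed by the
        -- next ghost edge or annihilates it.
        by_cases hw : E.IsWalkFrom (E.range e) l
        · rw [ghostProd_mul_vertex hw, ih hl hm]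
        · cases l with
          | nil => exact absurd trivial hw
          | cons g l =>
            by_cases hg : E.source g = E.range e
            · rw [ghostProd, mul_assoc _ (ghost R E g), ghost_mul_vertex hg, ← ghostProd, ih hl hm]
            · rw [ghostProd, mul_assoc _ (ghost R E g), ghost_mul_vertex_of_ne hg, mul_zero, zero_mul]
      · rw [ghost_mul_edge_of_ne hef, zero_mul, mul_zero]

theorem ghostProd_mul_pathProd_of_ne {v w : V} {l m : List A} (hl : E.IsWalkFrom v l)
    (hm : E.IsWalkFrom w m) (h : v ≠ w) : ghostProd R E v l * pathProd R E w m = 0 := by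
  rw [← ghostProd_mul_vertex hl, ← vertex_mul_pathProd hm, mul_assoc, ← mul_assoc (vertex R E v),
    vertex_mul_of_ne h, zero_mul, mul_zero]

/-! ### Generation and spanning -/

theorem eq_top_of_generators (M : Submodule R (LeavittPathAlgebra R E))
    (hv : ∀ v, vertex R E v ∈ M) (he : ∀ e, edge R E e ∈ M) (hg : ∀ e, ghost R E e ∈ M)
    (mv : ∀ v, ∀ x ∈ M, vertex R E v * x ∈ M) (me : ∀ e, ∀ x ∈ M, edge R E e * x ∈ M)
    (mg : ∀ e, ∀ x ∈ M, ghost R E e * x ∈ M) : M = ⊤ := by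
  rw [eq_top_iff]
  rintro x -
  obtain ⟨x, rfl⟩ := mk_surjective x
  change mkHom R E x ∈ M
  induction x using MonoidAlgebra.induction_linear with
  | zero => rw [map_zero]; exact M.zero_mem
  | add x y hx hy => rw [map_add]; exact M.add_mem hx hy
  | single w r =>
    have hw : mkHom R E (MonoidAlgebra.single w 1) ∈ M := by
      induction w using FreeSemigroup.recOnMul with
      | ih1 x =>
        cases x with
        | vertex v => exact hv v
        | edge e => exact he e
        | ghost e => exact hg e
      | ih2 x y _ hy =>
        have : (MonoidAlgebra.single (FreeSemigroup.of x * y) 1 : LeavittFree R V A) =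
            LeavittFree.of R x * MonoidAlgebra.single y 1 := by
          rw [LeavittFree.of, MonoidAlgebra.single_mul_single, one_mul]
        rw [this, map_mul]
        cases x with
        | vertex v => exact mv v _ hy
        | edge e => exact me e _ hy
        | ghost e => exact mg e _ hy
    have : (MonoidAlgebra.single w r : LeavittFree R V A) = r • MonoidAlgebra.single w 1 := by
      simp
    rw [this, map_smul]
    exact M.smul_mem r hw

/-- The algebra is spanned by the elements `αβ*`. -/
theorem span_monomials : Submodule.span R {x : LeavittPathAlgebra R E | ∃ α β : E.Path,
    x = ofPath R α * ofPathStar R β} = ⊤ := by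
  set M := Submodule.span R {x : LeavittPathAlgebra R E | ∃ α β : E.Path,
    x = ofPath R α * ofPathStar R β} with hM
  have mem : ∀ {v w : V} {l m : List A}, E.IsWalkFrom v l → E.IsWalkFrom w m →
      pathProd R E v l * ghostProd R E w m ∈ M := fun {v w l m} hl hm =>
    Submodule.subset_span ⟨⟨v, l, hl⟩, ⟨w, m, hm⟩, rfl⟩
  have left : ∀ a : LeavittPathAlgebra R E, (∀ (v w : V) (l m : List A), E.IsWalkFrom v l →
      E.IsWalkFrom w m → a * (pathProd R E v l * ghostProd R E w m) ∈ M) →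
      ∀ x ∈ M, a * x ∈ M := by
    intro a ha x hx
    have : M ≤ M.comap (LinearMap.mulLeft R a) := by
      conv_lhs => rw [hM]
      rw [Submodule.span_le]
      rintro _ ⟨α, β, rfl⟩
      exact ha _ _ _ _ α.isWalk β.isWalk
    exact this hx
  have hvm : ∀ u : V, ∀ (v w : V) (l m : List A), E.IsWalkFrom v l →
      E.IsWalkFrom w m → vertex R E u * (pathProd R E v l * ghostProd R E w m) ∈ M := by
    intro u v w l m hl hm
    by_cases h : u = v
    · subst h; rw [← mul_assoc, vertex_mul_pathProd hl]; exact mem hl hm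
    · rw [← vertex_mul_pathProd hl, ← mul_assoc, ← mul_assoc, vertex_mul_of_ne h, zero_mul, zero_mul]
      exact M.zero_mem
  have hem : ∀ e : A, ∀ (v w : V) (l m : List A), E.IsWalkFrom v l →
      E.IsWalkFrom w m → edge R E e * (pathProd R E v l * ghostProd R E w m) ∈ M := by
    intro e v w l m hl hm
    by_cases h : E.range e = v
    · subst h
      rw [← mul_assoc]
      exact mem (v := E.source e) (l := e :: l) ⟨rfl, hl⟩ hm
    · rw [← vertex_mul_pathProd hl, ← mul_assoc, ← mul_assoc, edge_mul_vertex_of_ne h]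
      simp
  have hgm : ∀ e : A, ∀ (v w : V) (l m : List A), E.IsWalkFrom v l →
      E.IsWalkFrom w m → ghost R E e * (pathProd R E v l * ghostProd R E w m) ∈ M := by
    intro e v w l m hl hm
    by_cases h : E.source e = v
    · subst h
      cases l with
      | nil =>
        by_cases hend : E.source e = E.endOf w m
        -- Here e*β* = (βe)*, so the ghost edge is appended at the end of `m`, and r(e) serves as
        -- the new path of length zero.
        · have key : ∀ (w : V) (m : List A), E.source e = E.endOf w m →
              vertex R E (E.range e) * ghostProd R E w (m ++ [e]) =
                ghost R E e * ghostProd R E w m := by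
            intro w m h
            induction m generalizing w with
            | nil =>
              change E.source e = w at h
              change vertex R E _ * (vertex R E _ * ghost R E e) = ghost R E e * vertex R E w
              rw [vertex_mul_ghost rfl, vertex_mul_ghost rfl, ghost_mul_vertex h]
            | cons f m ih =>
              rw [List.cons_append, ghostProd, ghostProd, ← mul_assoc, ih _ h, mul_assoc]
          rw [← mul_assoc, pathProd, ghost_mul_vertex rfl, ← key w m hend]
          exact mem (v := E.range e) (l := []) trivial
            (DirectedGraph.isWalkFrom_append.2 ⟨hm, hend, trivial⟩)
        · rw [pathProd, ← vertex_mul_ghostProd w m, ← mul_assoc (vertex R E (E.source e)),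
            vertex_mul_of_ne hend]
          simp
      | cons f l =>
        rw [pathProd, mul_assoc, ← mul_assoc]
        by_cases hef : e = f
        · subst hef
          rw [ghost_mul_edge_self]
          exact hvm _ _ _ _ _ hl.2 hm
        · rw [ghost_mul_edge_of_ne hef, zero_mul]; exact M.zero_mem
    · rw [← vertex_mul_pathProd hl, ← mul_assoc, ← mul_assoc, ghost_mul_vertex_of_ne h]
      simp
  have hV : ∀ v, vertex R E v ∈ M := fun v => by
    simpa [pathProd, ghostProd, vertex_mul_self] using
      mem (v := v) (w := v) (l := []) (m := []) trivial trivial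
  refine eq_top_of_generators M hV ?_ ?_ (fun v => left _ (hvm v)) (fun e => left _ (hem e))
    (fun e => left _ (hgm e))
  · intro e
    rw [← edge_mul_vertex (rfl : E.range e = _)]
    exact left _ (hem e) _ (hV _)
  · intro e
    rw [← ghost_mul_vertex (rfl : E.source e = _)]
    exact left _ (hgm e) _ (hV _)

/-- Finite sums of vertices are local units. -/
theorem eventually_mul_sum_vertex (x : LeavittPathAlgebra R E) :
    ∀ᶠ W : Finset V in Filter.atTop, x * ∑ w ∈ W, vertex R E w = x := by
  have hx : x ∈ Submodule.span R {x : LeavittPathAlgebra R E | ∃ α β : E.Path,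
    x = ofPath R α * ofPathStar R β} := span_monomials (R := R) (E := E) ▸ Submodule.mem_top
  induction hx using Submodule.span_induction with
  | mem x hx =>
    obtain ⟨α, β, rfl⟩ := hx
    filter_upwards [Filter.eventually_ge_atTop {β.start}] with W hW
    have hβ := ghostProd_mul_vertex (R := R) β.isWalk
    rw [mul_assoc, Finset.mul_sum, Finset.sum_eq_single β.start]
    · rw [ofPathStar, hβ]
    · intro w _ hw
      rw [ofPathStar, ← hβ, mul_assoc, vertex_mul_of_ne hw.symm, mul_zero]
    · exact fun h => absurd (hW (Finset.mem_singleton_self _)) h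
  | zero => simp
  | add x y _ _ hx hy => filter_upwards [hx, hy] with W h₁ h₂ using by rw [add_mul, h₁, h₂]
  | smul r x _ hx => filter_upwards [hx] with W h using by rw [smul_mul_assoc, h]

theorem exists_mul_sum_vertex (x : LeavittPathAlgebra R E) :
    ∃ W : Finset V, x * ∑ w ∈ W, vertex R E w = x :=
  (eventually_mul_sum_vertex x).exists

theorem sum_mem_ideal {B ι : Type*} [NonUnitalNonAssocRing B] (I : TwoSidedIdeal B) (s : Finset ι)
    {f : ι → B} (h : ∀ i ∈ s, f i ∈ I) : ∑ i ∈ s, f i ∈ I :=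
  sum_mem h

/-! ### The idempotents v - ∑ ee* -/

/-- The element `v - ∑ ee*`, where `e` runs through a finite set of edges. -/
noncomputable def gap (R : Type*) {V A : Type*} [CommRing R] (E : DirectedGraph V A) (v : V)
    (F : Finset A) : LeavittPathAlgebra R E :=
  vertex R E v - ∑ e ∈ F, edge R E e * ghost R E e

theorem gap_empty (v : V) : gap R E v ∅ = vertex R E v := by
  simp [gap]

theorem gap_emitted {v : V} (hne : (E.emitted v).Nonempty) (hfin : (E.emitted v).Finite) :
    gap R E v hfin.toFinset = 0 :=
  sub_eq_zero.2 ((isLeavittFamily R E).vertex_eq_sum v hne hfin)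

theorem gap_mul_edge {v : V} {F : Finset A} {e : A} (he : e ∈ F) (hv : E.source e = v) :
    gap R E v F * edge R E e = 0 := by
  rw [gap, sub_mul, vertex_mul_edge hv, Finset.sum_mul, Finset.sum_eq_single e, mul_assoc,
    ghost_mul_edge_self, edge_mul_vertex rfl, sub_self]
  · intro f _ hf
    rw [mul_assoc, ghost_mul_edge_of_ne hf, mul_zero]
  · exact fun h => absurd he h

theorem gap_mul_edge_of_notMem {v : V} {F : Finset A} {e : A} (he : e ∉ F) (hv : E.source e = v) :
    gap R E v F * edge R E e = edge R E e := by
  rw [gap, sub_mul, vertex_mul_edge hv, Finset.sum_mul, Finset.sum_eq_zero, sub_zero]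
  intro f hf
  rw [mul_assoc, ghost_mul_edge_of_ne (ne_of_mem_of_not_mem hf he), mul_zero]

theorem vertex_mul_gap {v : V} {F : Finset A} (hF : ∀ e ∈ F, E.source e = v) :
    vertex R E v * gap R E v F = gap R E v F := by
  rw [gap, mul_sub, vertex_mul_self, Finset.mul_sum]
  congr 1
  exact Finset.sum_congr rfl fun e he => by rw [← mul_assoc, vertex_mul_edge (hF e he)]

theorem gap_mul_vertex {v : V} {F : Finset A} (hF : ∀ e ∈ F, E.source e = v) :
    gap R E v F * vertex R E v = gap R E v F := by
  rw [gap, sub_mul, vertex_mul_self, Finset.sum_mul]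
  congr 1
  exact Finset.sum_congr rfl fun e he => by rw [mul_assoc, ghost_mul_vertex (hF e he)]

theorem gap_mul_gap {v : V} {F : Finset A} (hF : ∀ e ∈ F, E.source e = v) :
    gap R E v F * gap R E v F = gap R E v F := by
  conv_lhs => rhs; rw [gap]
  rw [mul_sub, gap_mul_vertex hF, Finset.mul_sum, Finset.sum_eq_zero, sub_zero]
  intro e he
  rw [← mul_assoc, gap_mul_edge he (hF e he), zero_mul]

theorem isBasicIdeal_iff_gap {I : TwoSidedIdeal (LeavittPathAlgebra R E)} :
    IsBasicIdeal I ↔ ∀ (r : R) (v : V) (F : Finset A), r ≠ 0 → (∀ e ∈ F, E.source e = v) →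
      r • gap R E v F ∈ I → gap R E v F ∈ I := by
  refine ⟨fun h => h.2, fun h => ⟨fun r v hr => ?_, h⟩⟩
  simpa only [gap_empty] using h r v ∅ hr (by simp)

theorem edge_mem_of_range_mem (I : TwoSidedIdeal (LeavittPathAlgebra R E)) {e : A}
    (h : vertex R E (E.range e) ∈ I) : edge R E e ∈ I := by
  rw [← edge_mul_vertex (rfl : E.range e = _)]
  exact I.mul_mem_left _ _ h

/-- Edges with range in an ideal do not contribute to `v - ∑ ee*` modulo the ideal. -/
theorem gap_sub_gap_mem (I : TwoSidedIdeal (LeavittPathAlgebra R E)) (v : V) {F F' : Finset A}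
    (hsub : F' ⊆ F) (h : ∀ e ∈ F, e ∉ F' → vertex R E (E.range e) ∈ I) :
    gap R E v F' - gap R E v F ∈ I := by
  classical
  rw [gap, gap, sub_sub_sub_cancel_left, ← Finset.sum_sdiff hsub, add_sub_cancel_right]
  refine sum_mem_ideal I _ fun e he => ?_
  rw [Finset.mem_sdiff] at he
  exact I.mul_mem_right _ _ (edge_mem_of_range_mem I (h e he.1 he.2))

end LeavittPathAlgebra

/-! ### Branching systems and their representations -/

/-- A branching system of the graph `E` on the set `X`: disjoint sets `D v` and injections
`cons e` of `D (r(e))` into `D (s(e))` with disjoint images, which cover `D v` if `v` emits at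
least one and only finitely many edges. -/
structure BranchingSystem {V A : Type*} (E : DirectedGraph V A) (X : Type*) where
  D : V → Set X
  cons : A → X → X
  disjoint : ∀ {v w x}, x ∈ D v → x ∈ D w → v = w
  cons_mem : ∀ e y, y ∈ D (E.range e) → cons e y ∈ D (E.source e)
  cons_inj : ∀ {e e' y y'}, y ∈ D (E.range e) → y' ∈ D (E.range e') → cons e y = cons e' y' →
    e = e' ∧ y = y'
  exists_cons : ∀ v, (E.emitted v).Nonempty → (E.emitted v).Finite → ∀ x ∈ D v,
    ∃ e y, y ∈ D (E.range e) ∧ cons e y = x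

namespace BranchingSystem

open LeavittPathAlgebra
open scoped Classical

variable {R V A X : Type*} [CommRing R] {E : DirectedGraph V A} (S : BranchingSystem E X)

/-- The set of the points `ey`. -/
def image (e : A) : Set X :=
  {x | ∃ y, y ∈ S.D (E.range e) ∧ S.cons e y = x}

theorem mem_D_of_mem_image {e : A} {x : X} (h : x ∈ S.image e) : x ∈ S.D (E.source e) := by
  obtain ⟨y, hy, rfl⟩ := h
  exact S.cons_mem e y hy

theorem eq_of_mem_image {e f : A} {x : X} (h : x ∈ S.image e) (h' : x ∈ S.image f) : e = f := by
  obtain ⟨y, hy, rfl⟩ := h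
  obtain ⟨y', hy', h⟩ := h'
  exact (S.cons_inj hy' hy h).1.symm

/-- Multiplication by the indicator function of a set. -/
noncomputable def proj (R : Type*) {X : Type*} [CommRing R] (U : Set X) : Module.End R (X → R) where
  toFun f x := if x ∈ U then f x else 0
  map_add' f g := by ext x; by_cases h : x ∈ U <;> simp [h]
  map_smul' r f := by ext x; by_cases h : x ∈ U <;> simp [h]

/-- The operator of an edge. -/
noncomputable def edgeOp (R : Type*) [CommRing R] (e : A) : Module.End R (X → R) where
  toFun f x := if h : x ∈ S.image e then f h.choose else 0
  map_add' f g := by ext x; by_cases h : x ∈ S.image e <;> simp [h]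
  map_smul' r f := by ext x; by_cases h : x ∈ S.image e <;> simp [h]

/-- The operator of a ghost edge. -/
noncomputable def ghostOp (R : Type*) [CommRing R] (e : A) : Module.End R (X → R) where
  toFun f y := if y ∈ S.D (E.range e) then f (S.cons e y) else 0
  map_add' f g := by ext y; by_cases h : y ∈ S.D (E.range e) <;> simp [h]
  map_smul' r f := by ext y; by_cases h : y ∈ S.D (E.range e) <;> simp [h]

theorem proj_apply (U : Set X) (f : X → R) (x : X) : proj R U f x = if x ∈ U then f x else 0 :=
  rfl

theorem ghostOp_apply (e : A) (f : X → R) (y : X) :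
    S.ghostOp R e f y = if y ∈ S.D (E.range e) then f (S.cons e y) else 0 :=
  rfl

theorem edgeOp_of_notMem {e : A} {x : X} (f : X → R) (h : x ∉ S.image e) :
    S.edgeOp R e f x = 0 :=
  dif_neg h

/-- The point chosen in `edgeOp` is forced, since `cons e` is injective on `D (r(e))`. -/
theorem edgeOp_cons {e : A} {y : X} (f : X → R) (hy : y ∈ S.D (E.range e)) :
    S.edgeOp R e f (S.cons e y) = f y := by
  have h : S.cons e y ∈ S.image e := ⟨y, hy, rfl⟩
  refine (dif_pos h).trans (congrArg f ?_)
  exact (S.cons_inj h.choose_spec.1 hy h.choose_spec.2).2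

theorem edgeOp_mul_ghostOp (e : A) : S.edgeOp R e * S.ghostOp R e = proj R (S.image e) := by
  ext1 f
  funext x
  rw [Module.End.mul_apply, proj_apply]
  by_cases h : x ∈ S.image e
  · rw [if_pos h]
    obtain ⟨y, hy, rfl⟩ := h
    rw [S.edgeOp_cons _ hy, ghostOp_apply, if_pos hy]
  · rw [if_neg h, S.edgeOp_of_notMem _ h]

theorem sum_proj_image (F : Finset A) :
    ∑ e ∈ F, proj R (S.image e) = proj R {x | ∃ e ∈ F, x ∈ S.image e} := by
  ext1 f
  funext x
  rw [LinearMap.sum_apply, Finset.sum_apply, proj_apply]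
  simp only [proj_apply]
  by_cases h : ∃ e ∈ F, x ∈ S.image e
  · rw [if_pos (show x ∈ {x | ∃ e ∈ F, x ∈ S.image e} from h)]
    obtain ⟨e, he, hx⟩ := h
    rw [Finset.sum_eq_single e, if_pos hx]
    · exact fun f _ hne => if_neg fun h' => hne (S.eq_of_mem_image h' hx)
    · exact fun h => absurd he h
  · rw [if_neg (show x ∉ {x | ∃ e ∈ F, x ∈ S.image e} from h)]
    exact Finset.sum_eq_zero fun e he => if_neg fun hx => h ⟨e, he, hx⟩

theorem isLeavittFamily (R : Type*) [CommRing R] :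
    IsLeavittFamily E (fun v => proj R (S.D v)) (S.edgeOp R) (S.ghostOp R) where
  idempotent v := by
    ext1 f
    funext x
    by_cases h : x ∈ S.D v <;> simp [proj_apply, h]
  orthogonal v w hvw := by
    ext1 f
    funext x
    by_cases h : x ∈ S.D v
    · simp [proj_apply, show x ∉ S.D w from fun h' => hvw (S.disjoint h h')]
    · simp [proj_apply, h]
  source_mul e := by
    ext1 f
    funext x
    rw [Module.End.mul_apply, proj_apply]
    split_ifs with h
    · rfl
    · rw [S.edgeOp_of_notMem f fun h' => h (S.mem_D_of_mem_image h')]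
  mul_range e := by
    ext1 f
    funext x
    rw [Module.End.mul_apply]
    by_cases h : x ∈ S.image e
    · obtain ⟨y, hy, rfl⟩ := h
      rw [S.edgeOp_cons _ hy, S.edgeOp_cons _ hy, proj_apply, if_pos hy]
    · rw [S.edgeOp_of_notMem _ h, S.edgeOp_of_notMem _ h]
  range_mul e := by
    ext1 f
    funext x
    by_cases h : x ∈ S.D (E.range e) <;> simp [proj_apply, ghostOp_apply, h]
  mul_source e := by
    ext1 f
    funext x
    by_cases h : x ∈ S.D (E.range e)
    · simp [proj_apply, ghostOp_apply, h, S.cons_mem e x h]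
    · simp [ghostOp_apply, h]
  ghost_mul_self e := by
    ext1 f
    funext x
    rw [Module.End.mul_apply, ghostOp_apply, proj_apply]
    split_ifs with h
    · exact S.edgeOp_cons f h
    · rfl
  ghost_mul_ne e e' hne := by
    ext1 f
    funext x
    rw [Module.End.mul_apply, ghostOp_apply]
    split_ifs with h
    · exact S.edgeOp_of_notMem f fun h' => hne (S.eq_of_mem_image ⟨x, h, rfl⟩ h')
    · rfl
  vertex_eq_sum v hne hfin := by
    simp only [edgeOp_mul_ghostOp, sum_proj_image]
    congr 1
    ext x
    simp only [Set.Finite.mem_toFinset, Set.mem_ofPred_eq]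
    constructor
    · intro hx
      obtain ⟨e, y, hy, rfl⟩ := S.exists_cons v hne hfin x hx
      exact ⟨e, S.disjoint (S.cons_mem e y hy) hx, y, hy, rfl⟩
    · rintro ⟨e, he, hx⟩
      have : E.source e = v := he
      exact this ▸ S.mem_D_of_mem_image hx

/-- The representation on the functions on `X`. -/
noncomputable def rep (R : Type*) [CommRing R] :
    LeavittPathAlgebra R E →ₙₐ[R] Module.End R (X → R) :=
  (existsUnique_lift (S.isLeavittFamily R)).choose

theorem rep_vertex (v : V) : S.rep R (vertex R E v) = proj R (S.D v) :=
  (existsUnique_lift (S.isLeavittFamily R)).choose_spec.1.1 v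

theorem rep_edge (e : A) : S.rep R (edge R E e) = S.edgeOp R e :=
  (existsUnique_lift (S.isLeavittFamily R)).choose_spec.1.2.1 e

theorem rep_ghost (e : A) : S.rep R (ghost R E e) = S.ghostOp R e :=
  (existsUnique_lift (S.isLeavittFamily R)).choose_spec.1.2.2 e

theorem rep_gap {v : V} {F : Finset A} (hF : ∀ e ∈ F, E.source e = v) :
    S.rep R (gap R E v F) = proj R (S.D v \ {x | ∃ e ∈ F, x ∈ S.image e}) := by
  simp only [gap, map_sub, map_sum, map_mul, rep_vertex, rep_edge, rep_ghost, edgeOp_mul_ghostOp,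
    sum_proj_image]
  ext1 f
  funext x
  rw [LinearMap.sub_apply, Pi.sub_apply, proj_apply, proj_apply, proj_apply]
  by_cases h : ∃ e ∈ F, x ∈ S.image e
  · have hx : x ∈ S.D v := by
      obtain ⟨e, he, hx⟩ := h
      exact hF e he ▸ S.mem_D_of_mem_image hx
    simp [h, hx]
  · simp [h]

/-- Applied to the constant function 1, the operator returns `r` at each point of `U`. Zero divisors
in `R` do no harm because indicators only take the values 0 and 1. -/
theorem smul_proj_eq_zero_iff {r : R} (hr : r ≠ 0) {U : Set X} : r • proj R U = 0 ↔ U = ∅ := by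
  constructor
  · intro h
    refine Set.eq_empty_of_forall_notMem fun x hx => hr ?_
    have := congrFun (LinearMap.congr_fun h fun _ => 1) x
    simpa [proj_apply, hx] using this
  · rintro rfl
    ext1 f
    funext x
    simp [proj_apply]

/-- The kernel of the representation. -/
noncomputable def ker (R : Type*) [CommRing R] : TwoSidedIdeal (LeavittPathAlgebra R E) :=
  TwoSidedIdeal.ker (S.rep R)

theorem mem_ker {x : LeavittPathAlgebra R E} : x ∈ S.ker R ↔ S.rep R x = 0 :=
  TwoSidedIdeal.mem_ker _

theorem smul_gap_mem_ker_iff {r : R} (hr : r ≠ 0) {v : V} {F : Finset A}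
    (hF : ∀ e ∈ F, E.source e = v) :
    r • gap R E v F ∈ S.ker R ↔ ∀ x ∈ S.D v, ∃ e ∈ F, x ∈ S.image e := by
  rw [mem_ker, map_smul, S.rep_gap hF, smul_proj_eq_zero_iff hr, Set.sdiff_eq_empty]
  rfl

theorem smul_vertex_mem_ker_iff {r : R} (hr : r ≠ 0) {v : V} :
    r • vertex R E v ∈ S.ker R ↔ S.D v = ∅ := by
  rw [mem_ker, map_smul, S.rep_vertex, smul_proj_eq_zero_iff hr]

theorem gap_mem_ker_iff [Nontrivial R] {v : V} {F : Finset A} (hF : ∀ e ∈ F, E.source e = v) :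
    gap R E v F ∈ S.ker R ↔ ∀ x ∈ S.D v, ∃ e ∈ F, x ∈ S.image e := by
  rw [← S.smul_gap_mem_ker_iff (one_ne_zero (α := R)) hF, one_smul]

theorem vertex_mem_ker_iff [Nontrivial R] {v : V} :
    vertex R E v ∈ S.ker R ↔ S.D v = ∅ := by
  rw [← S.smul_vertex_mem_ker_iff (one_ne_zero (α := R)), one_smul]

theorem isBasicIdeal_ker [Nontrivial R] : IsBasicIdeal (S.ker R) :=
  isBasicIdeal_iff_gap.2 fun _ _ _ hr hF h =>
    (S.gap_mem_ker_iff hF).2 ((S.smul_gap_mem_ker_iff hr hF).1 h)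

end BranchingSystem

namespace DirectedGraph.AdmissiblePair

open LeavittPathAlgebra
open scoped Classical

variable {R V A : Type*} [CommRing R] {E : DirectedGraph V A} (P : E.AdmissiblePair)

/-! ### The branching system of an admissible pair -/

/-- The vertices which are regular relative to `(H, S)`. -/
def IsRegular (v : V) : Prop :=
  (E.emittedOutside P.H v).Nonempty ∧ (E.emittedOutside P.H v).Finite ∧
    ((E.emitted v).Finite ∨ v ∈ P.S)

/-- The factor ℕ makes the countable set of pairs infinite as soon as there is an edge, so a
bijection onto ℕ exists in the regular case. Otherwise a shift by one keeps 0 out of the image. -/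
theorem exists_coding_at [Countable A] (v : V) :
    ∃ h : E.emittedOutside P.H v × ℕ → ℕ, h.Injective ∧
      (P.IsRegular v ↔ h.Surjective) := by
  by_cases hv : P.IsRegular v
  · have : Nonempty (E.emittedOutside P.H v) := hv.1.to_subtype
    obtain ⟨h⟩ := nonempty_denumerable (E.emittedOutside P.H v × ℕ)
    exact ⟨_, (Denumerable.eqv _).injective, fun _ => (Denumerable.eqv _).surjective, fun _ => hv⟩
  · obtain ⟨h, hh⟩ := Countable.exists_injective_nat (E.emittedOutside P.H v × ℕ)
    refine ⟨Nat.succ ∘ h, Nat.succ_injective.comp hh, fun h => absurd h hv, fun hs => ?_⟩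
    obtain ⟨x, hx⟩ := hs 0
    exact absurd hx (Nat.succ_ne_zero _)

theorem exists_coding [Countable A] :
    ∃ g : A → ℕ → ℕ, (∀ e e' n n', E.source e = E.source e' → E.range e ∉ P.H →
      E.range e' ∉ P.H → g e n = g e' n' → e = e' ∧ n = n') ∧
      ∀ v, P.IsRegular v ↔ ∀ n, ∃ e m, E.source e = v ∧ E.range e ∉ P.H ∧ g e m = n := by
  choose h hinj hsurj using P.exists_coding_at
  -- The value 0 is a dummy: in the branching system the fibre over a vertex of `H` is empty.
  refine ⟨fun e n => if he : E.range e ∉ P.H then h (E.source e) (⟨e, rfl, he⟩, n) else 0, ?_, ?_⟩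
  · intro e e' n n' hs he he' heq
    simp only [he, he', not_false_eq_true, dif_pos] at heq
    have key : ∀ (v : V) (h₁ : e ∈ E.emittedOutside P.H v) (h₂ : e' ∈ E.emittedOutside P.H v),
        h v (⟨e, h₁⟩, n) = h v (⟨e', h₂⟩, n') → e = e' ∧ n = n' := fun v h₁ h₂ heq => by
      simpa using hinj v heq
    refine key (E.source e) ⟨rfl, he⟩ ⟨hs.symm, he'⟩ (heq.trans ?_)
    congr 1 <;> grind
  · intro v
    rw [hsurj]
    constructor
    · intro hs n
      obtain ⟨⟨⟨e, rfl, he⟩, m⟩, hm⟩ := hs n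
      exact ⟨e, m, rfl, he, (dif_pos he).trans hm⟩
    · intro hs n
      obtain ⟨e, m, rfl, he, hm⟩ := hs n
      exact ⟨(⟨e, rfl, he⟩, m), (dif_pos he).symm.trans hm⟩

/-- The coding of the pairs of an edge with range outside `H` and a natural number. -/
noncomputable def coding [Countable A] : A → ℕ → ℕ :=
  P.exists_coding.choose

theorem coding_inj [Countable A] {e e' : A} {n n' : ℕ} (hs : E.source e = E.source e')
    (he : E.range e ∉ P.H) (he' : E.range e' ∉ P.H) (h : P.coding e n = P.coding e' n') :
    e = e' ∧ n = n' :=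
  P.exists_coding.choose_spec.1 e e' n n' hs he he' h

theorem isRegular_iff [Countable A] (v : V) : P.IsRegular v ↔
    ∀ n, ∃ e m, E.source e = v ∧ E.range e ∉ P.H ∧ P.coding e m = n :=
  P.exists_coding.choose_spec.2 v

/-- A branching system whose kernel meets the vertices in `H` and detects `S`. -/
noncomputable def branchingSystem [Countable A] : BranchingSystem E (V × ℕ) where
  D v := {p | p.1 = v ∧ v ∉ P.H}
  cons e p := (E.source e, P.coding e p.2)
  disjoint h h' := h.1.symm.trans h'.1
  cons_mem e _ hy := ⟨rfl, fun h => hy.2 (P.hereditary e h)⟩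
  cons_inj {e e' y y'} hy hy' h := by
    obtain ⟨h₁, h₂⟩ := Prod.ext_iff.1 h
    obtain ⟨rfl, h₃⟩ := P.coding_inj h₁ hy.2 hy'.2 h₂
    exact ⟨rfl, Prod.ext (hy.1.trans hy'.1.symm) h₃⟩
  exists_cons v hne hfin x hx := by
    have hreg : P.IsRegular v := by
      refine ⟨?_, hfin.subset fun e he => he.1, Or.inl hfin⟩
      by_contra h
      -- Were all edges from `v` to end in `H`, saturation would put `v` in `H`, where the fibre has
      -- no point `x`.
      refine hx.2 (P.saturated v hne hfin fun e he => ?_)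
      by_contra h'
      exact h ⟨e, he, h'⟩
    obtain ⟨e, m, h₁, h₂, h₃⟩ := (P.isRegular_iff v).1 hreg x.2
    exact ⟨e, (E.range e, m), ⟨rfl, h₂⟩, Prod.ext (h₁.trans hx.1.symm) h₃⟩

theorem D_eq_empty_iff [Countable A] {v : V} : P.branchingSystem.D v = ∅ ↔ v ∈ P.H := by
  constructor
  · intro h
    by_contra hv
    exact (h ▸ (⟨rfl, hv⟩ : (v, 0) ∈ P.branchingSystem.D v) : (v, 0) ∈ (∅ : Set (V × ℕ)))
  · exact fun h => Set.eq_empty_of_forall_notMem fun x hx => hx.2 h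

theorem isRegular_iff_cover [Countable A] {v : V} (hv : v ∉ P.H) :
    P.IsRegular v ↔ ∀ x ∈ P.branchingSystem.D v,
      ∃ e, e ∈ E.emittedOutside P.H v ∧ x ∈ P.branchingSystem.image e := by
  rw [isRegular_iff]
  constructor
  · rintro h ⟨w, n⟩ hx
    obtain rfl : w = v := hx.1
    obtain ⟨e, m, h₁, h₂, h₃⟩ := h n
    exact ⟨e, ⟨h₁, h₂⟩, (E.range e, m), ⟨rfl, h₂⟩, Prod.ext h₁ h₃⟩
  · intro h n
    obtain ⟨e, he, y, hy, hx⟩ := h (v, n) ⟨rfl, hv⟩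
    exact ⟨e, y.2, he.1, he.2, (Prod.ext_iff.1 hx).2⟩

/-! ### Vertices and breaking elements in I(H, S) -/

theorem vertex_mem_idealOfPair {v : V} (hv : v ∈ P.H) : vertex R E v ∈ idealOfPair R P :=
  TwoSidedIdeal.subset_span (Or.inl ⟨v, hv, rfl⟩)

/-- For v ∈ S this is the generator v^H. For a finite emitter, v - ∑ ee* over all edges is zero, and
the edges into `H` vanish modulo the ideal. -/
theorem gap_mem_idealOfPair {v : V} (h : P.IsRegular v) :
    gap R E v h.2.1.toFinset ∈ idealOfPair R P := by
  by_cases hS : v ∈ P.S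
  · exact TwoSidedIdeal.subset_span (Or.inr ⟨v, hS, rfl⟩)
  · have hfin : (E.emitted v).Finite := h.2.2.resolve_right hS
    have := gap_sub_gap_mem (idealOfPair R P) v (F := hfin.toFinset) (F' := h.2.1.toFinset)
      (fun e he => by simp at he ⊢; exact he.1) (fun e he he' => P.vertex_mem_idealOfPair <| by
        simp only [Set.Finite.mem_toFinset] at he he'
        by_contra hr
        exact he' ⟨he, hr⟩)
    rwa [gap_emitted (h.1.mono fun e he => he.1), sub_zero] at this

theorem idealOfPair_le_ker [Countable A] [Nontrivial R] :
    idealOfPair R P ≤ P.branchingSystem.ker R := by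
  rw [idealOfPair, TwoSidedIdeal.span_le]
  rintro _ (⟨v, hv, rfl⟩ | ⟨v, hv, rfl⟩)
  · exact P.branchingSystem.vertex_mem_ker_iff.2 (P.D_eq_empty_iff.2 hv)
  · have hb := P.subset_breaking hv
    refine (P.branchingSystem.gap_mem_ker_iff fun e he => ?_).2 fun x hx => ?_
    · exact ((Set.Finite.mem_toFinset _).1 he).1
    · obtain ⟨e, he, hx⟩ := (P.isRegular_iff_cover hb.1).1 ⟨hb.2.2.1, hb.2.2.2, Or.inr hv⟩ x hx
      exact ⟨e, (Set.Finite.mem_toFinset _).2 he, hx⟩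

theorem mem_of_smul_vertex_mem [Countable A] [Nontrivial R] {r : R} (hr : r ≠ 0) {v : V}
    (h : r • vertex R E v ∈ idealOfPair R P) : v ∈ P.H :=
  P.D_eq_empty_iff.1 ((P.branchingSystem.smul_vertex_mem_ker_iff hr).1 (P.idealOfPair_le_ker h))

theorem vertex_mem_idealOfPair_iff [Countable A] [Nontrivial R] {v : V} :
    vertex R E v ∈ idealOfPair R P ↔ v ∈ P.H :=
  ⟨fun h => P.mem_of_smul_vertex_mem (one_ne_zero (α := R)) (by rwa [one_smul]),
    P.vertex_mem_idealOfPair⟩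

/-- In the kernel, the images of the edges in `F` must cover the fibre over `v`, which forces
regularity. An outside edge has a nonempty image; as images of distinct edges are disjoint, it must
itself belong to `F`. -/
theorem isRegular_of_smul_gap_mem [Countable A] [Nontrivial R] {r : R} (hr : r ≠ 0) {v : V}
    {F : Finset A} (hF : ∀ e ∈ F, E.source e = v) (hv : v ∉ P.H)
    (h : r • gap R E v F ∈ idealOfPair R P) :
    P.IsRegular v ∧ ∀ e ∈ E.emittedOutside P.H v, e ∈ F := by
  have hc := (P.branchingSystem.smul_gap_mem_ker_iff hr hF).1 (P.idealOfPair_le_ker h)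
  refine ⟨(P.isRegular_iff_cover hv).2 fun x hx => ?_, fun e he => ?_⟩
  · obtain ⟨e, he, hx⟩ := hc x hx
    refine ⟨e, ⟨hF e he, ?_⟩, hx⟩
    obtain ⟨y, hy, -⟩ := hx
    exact hy.2
  · have hx : P.branchingSystem.cons e (E.range e, 0) ∈ P.branchingSystem.image e :=
      ⟨_, ⟨rfl, he.2⟩, rfl⟩
    obtain ⟨f, hf, hx'⟩ := hc _ (he.1 ▸ P.branchingSystem.mem_D_of_mem_image hx)
    exact P.branchingSystem.eq_of_mem_image hx hx' ▸ hf

theorem breakingElement_mem_iff [Countable A] [Nontrivial R] {v : V} (hv : v ∈ E.breaking P.H) :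
    breakingElement R E P.H v hv ∈ idealOfPair R P ↔ v ∈ P.S := by
  constructor
  · intro h
    have h' : (1 : R) • gap R E v hv.2.2.2.toFinset ∈ idealOfPair R P := by rwa [one_smul]
    have := (P.isRegular_of_smul_gap_mem one_ne_zero
      (fun e he => ((Set.Finite.mem_toFinset _).1 he).1) hv.1 h').1
    exact this.2.2.resolve_left hv.2.1
  · exact fun h => TwoSidedIdeal.subset_span (Or.inr ⟨v, h, rfl⟩)

theorem isBasicIdeal_idealOfPair [Countable A] [Nontrivial R] :
    IsBasicIdeal (idealOfPair R P) := by
  rw [isBasicIdeal_iff_gap]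
  intro r v F hr hF h
  by_cases hv : v ∈ P.H
  · rw [← vertex_mul_gap hF]
    exact TwoSidedIdeal.mul_mem_right _ _ _ (P.vertex_mem_idealOfPair hv)
  · obtain ⟨hreg, hsub⟩ := P.isRegular_of_smul_gap_mem hr hF hv h
    have := gap_sub_gap_mem (idealOfPair R P) v (F := F) (F' := hreg.2.1.toFinset)
      (fun e he => hsub e ((Set.Finite.mem_toFinset _).1 he))
      (fun e he he' => P.vertex_mem_idealOfPair <| by
        by_contra hr
        exact he' ((Set.Finite.mem_toFinset _).2 ⟨hF e he, hr⟩))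
    simpa using TwoSidedIdeal.sub_mem _ (P.gap_mem_idealOfPair hreg) this

theorem idealOfPair_injective [Countable A] [Nontrivial R] :
    Function.Injective fun P : E.AdmissiblePair => idealOfPair R P := by
  intro P Q h
  replace h : idealOfPair R P = idealOfPair R Q := h
  have hH : P.H = Q.H := by
    ext v
    rw [← P.vertex_mem_idealOfPair_iff (R := R), h, Q.vertex_mem_idealOfPair_iff]
  refine DirectedGraph.AdmissiblePair.ext hH (Set.ext fun v => ?_)
  by_cases hv : v ∈ E.breaking P.H
  · have hv' : v ∈ E.breaking Q.H := hH ▸ hv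
    rw [← P.breakingElement_mem_iff (R := R) hv, h, ← Q.breakingElement_mem_iff (R := R) hv']
    simp only [hH]
  · exact ⟨fun h => absurd (P.subset_breaking h) hv,
      fun h => absurd (hH ▸ Q.subset_breaking h) hv⟩

end DirectedGraph.AdmissiblePair

/-! ### The branching system of a vertex with a single closed simple path -/

namespace DirectedGraph

open LeavittPathAlgebra

variable {V A : Type*} {E : DirectedGraph V A}

/-- `el` is a closed path at `u` which visits `u` only at the start and at the end. -/
structure IsFirstReturn (E : DirectedGraph V A) (u : V) (e : A) (l : List A) : Prop where
  source_eq : E.source e = u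
  isWalk : E.IsWalkFrom (E.range e) l
  endOf_eq : E.endOf (E.range e) l = u
  avoids : ∀ f ∈ l, E.source f ≠ u

theorem exists_unique_firstReturn_of_not_conditionK (h : ¬ E.ConditionK) :
    ∃ (u : V) (e₀ : A) (l₀ : List A), E.IsFirstReturn u e₀ l₀ ∧
      ∀ e l, E.IsFirstReturn u e l → e = e₀ ∧ l = l₀ := by
  simp only [ConditionK, not_forall, not_or, not_not] at h
  obtain ⟨v, ⟨α, hα⟩, h⟩ := h
  obtain ⟨u, l, hl⟩ := α
  obtain ⟨hpos, rfl, hend⟩ := hα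
  cases l with
  | nil => exact absurd hpos (by simp [Path.length])
  | cons e l =>
    -- Cutting the closed path at its first return gives one closed simple path; a different one
    -- would restore Condition (K) at this vertex.
    obtain ⟨m, h₁, h₂, h₃⟩ := exists_walk_avoiding hl.2 hend
    refine ⟨u, e, m, ⟨hl.1, h₁, h₂, h₃⟩, fun f k hk => ?_⟩
    by_contra hne
    refine h ⟨⟨u, f :: k, hk.1, hk.2⟩, ⟨u, e :: m, hl.1, h₁⟩, fun h => hne ?_,
      ⟨⟨by simp [Path.length], rfl, hk.3⟩, hk.4⟩, ⟨⟨by simp [Path.length], rfl, h₂⟩, h₃⟩⟩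
    simpa using congrArg Path.edges h

section firstVisit

variable {u : V} {e₀ : A} {l₀ : List A} (h₀ : E.IsFirstReturn u e₀ l₀)
  (huniq : ∀ e l, E.IsFirstReturn u e l → e = e₀ ∧ l = l₀)

open scoped Classical in
/-- The branching system on the walks which end at `u` and visit `u` only at the end. -/
noncomputable def firstVisitSystem : BranchingSystem E (List A) where
  D v := {l | E.IsWalkFrom v l ∧ E.endOf v l = u ∧ ∀ e ∈ l, E.source e ≠ u}
  -- Prepending an edge at `u` must give `[]`, the only point over `u`. Injectivity survives because
  -- only the pair `e₀`, `l₀` is collapsed this way.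
  cons e l := if E.source e = u then [] else e :: l
  disjoint {v w l} h h' := by
    cases l with
    | nil => exact h.2.1.trans h'.2.1.symm
    | cons e l => exact h.1.1.symm.trans h'.1.1
  cons_mem e l h := by
    by_cases he : E.source e = u
    · simp [he, IsWalkFrom, endOf]
    · simpa [he, IsWalkFrom, endOf] using h
  cons_inj {e e' l l'} h h' heq := by
    by_cases he : E.source e = u
    · by_cases he' : E.source e' = u
      · have h₁ := huniq e l ⟨he, h.1, h.2.1, h.2.2⟩
        have h₂ := huniq e' l' ⟨he', h'.1, h'.2.1, h'.2.2⟩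
        exact ⟨h₁.1.trans h₂.1.symm, h₁.2.trans h₂.2.symm⟩
      · simp [he, he'] at heq
    · by_cases he' : E.source e' = u
      · simp [he, he'] at heq
      · simpa [he, he'] using heq
  exists_cons v hne hfin l h := by
    cases l with
    | nil => exact ⟨e₀, l₀, ⟨h₀.isWalk, h₀.endOf_eq, h₀.avoids⟩, if_pos h₀.source_eq⟩
    | cons e l =>
      have h₃ := h.2.2
      simp only [List.mem_cons, forall_eq_or_imp] at h₃
      exact ⟨e, l, ⟨h.1.2, h.2.1, h₃.2⟩, if_neg h₃.1⟩

theorem nil_mem_firstVisitSystem_D {v : V} :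
    [] ∈ (firstVisitSystem h₀ huniq).D v ↔ v = u := by
  simp [firstVisitSystem, IsWalkFrom, endOf]

theorem eq_nil_of_mem_firstVisitSystem_D {l : List A} (h : l ∈ (firstVisitSystem h₀ huniq).D u) :
    l = [] := by
  cases l with
  | nil => rfl
  | cons e l => exact absurd h.1.1 (h.2.2 e (by simp))

open scoped Classical in
-- Only the value of `f` at `[]`, the single point over `u`, survives; prepending the edges of `l`
-- carries it to the point `l`.
theorem firstVisitSystem_rep_pathProd (R : Type*) [CommRing R] {v : V} {l : List A}
    (hl : l ∈ (firstVisitSystem h₀ huniq).D v) (f : List A → R) (x : List A) :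
    (firstVisitSystem h₀ huniq).rep R (pathProd R E v l) f x = if x = l then f [] else 0 := by
  induction l generalizing v x with
  | nil =>
    obtain rfl := (nil_mem_firstVisitSystem_D h₀ huniq).1 hl
    rw [pathProd, BranchingSystem.rep_vertex, BranchingSystem.proj_apply]
    by_cases h : x = []
    · subst h; simp [hl]
    · rw [if_neg h, if_neg fun h' => h (eq_nil_of_mem_firstVisitSystem_D h₀ huniq h')]
  | cons e l ih =>
    have h₃ := hl.2.2
    simp only [List.mem_cons, forall_eq_or_imp] at h₃
    have hl' : l ∈ (firstVisitSystem h₀ huniq).D (E.range e) := ⟨hl.1.2, hl.2.1, h₃.2⟩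
    rw [pathProd, map_mul, Module.End.mul_apply, BranchingSystem.rep_edge]
    by_cases hx : x ∈ (firstVisitSystem h₀ huniq).image e
    · obtain ⟨y, hy, rfl⟩ := hx
      rw [BranchingSystem.edgeOp_cons _ _ hy, ih hl']
      simp [firstVisitSystem, h₃.1]
    · rw [BranchingSystem.edgeOp_of_notMem _ _ hx, if_neg]
      rintro rfl
      exact hx ⟨l, hl', if_neg h₃.1⟩

/-- The return path sends the point `[]` to `cons e₀ l₀ = []`, so it acts as `u` does. -/
theorem vertex_sub_pathProd_mem_ker (R : Type*) [CommRing R] :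
    vertex R E u - pathProd R E u (e₀ :: l₀) ∈ (firstVisitSystem h₀ huniq).ker R := by
  classical
  have hl : l₀ ∈ (firstVisitSystem h₀ huniq).D (E.range e₀) :=
    ⟨h₀.isWalk, h₀.endOf_eq, h₀.avoids⟩
  rw [BranchingSystem.mem_ker, map_sub, sub_eq_zero]
  ext1 f
  funext x
  rw [← pathProd, firstVisitSystem_rep_pathProd h₀ huniq R
    ((nil_mem_firstVisitSystem_D h₀ huniq).2 rfl), pathProd, map_mul, Module.End.mul_apply,
    BranchingSystem.rep_edge]
  by_cases hx : x ∈ (firstVisitSystem h₀ huniq).image e₀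
  · obtain ⟨y, hy, rfl⟩ := hx
    have hy' : y = l₀ := (huniq e₀ y ⟨h₀.source_eq, hy.1, hy.2.1, hy.2.2⟩).2
    rw [BranchingSystem.edgeOp_cons _ _ hy, firstVisitSystem_rep_pathProd h₀ huniq R hl,
      if_pos hy', if_pos]
    exact if_pos h₀.source_eq
  · rw [BranchingSystem.edgeOp_of_notMem _ _ hx, if_neg]
    rintro rfl
    exact hx ⟨l₀, hl, if_pos h₀.source_eq⟩

theorem vertex_notMem_ker (R : Type*) [CommRing R] [Nontrivial R] :
    vertex R E u ∉ (firstVisitSystem h₀ huniq).ker R := by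
  rw [BranchingSystem.vertex_mem_ker_iff]
  exact fun h => (h ▸ (nil_mem_firstVisitSystem_D h₀ huniq).2 rfl : [] ∈ (∅ : Set (List A)))

end firstVisit

end DirectedGraph

namespace LeavittPathAlgebra

variable {R V A : Type*} [CommRing R] {E : DirectedGraph V A}

/-! ### The grading -/

/-- The relations are homogeneous for the degrees 0, 1, -1, so the universal property will give a
coaction. The unitization provides unital coefficients. -/
theorem isLeavittFamily_single (R : Type*) {V A : Type*} [CommRing R] (E : DirectedGraph V A) :
    IsLeavittFamily (B := AddMonoidAlgebra (Unitization R (LeavittPathAlgebra R E)) ℤ) E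
      (fun v => .single 0 (vertex R E v : Unitization R (LeavittPathAlgebra R E)))
      (fun e => .single 1 (edge R E e : Unitization R (LeavittPathAlgebra R E)))
      (fun e => .single (-1) (ghost R E e : Unitization R (LeavittPathAlgebra R E))) where
  idempotent v := by
    simp only [AddMonoidAlgebra.single_mul_single, ← Unitization.inr_mul, vertex_mul_self, add_zero]
  orthogonal v w h := by
    simp only [AddMonoidAlgebra.single_mul_single, ← Unitization.inr_mul, vertex_mul_of_ne h,
      Unitization.inr_zero, AddMonoidAlgebra.single_zero]
  source_mul e := by
    simp only [AddMonoidAlgebra.single_mul_single, ← Unitization.inr_mul, vertex_mul_edge, zero_add]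
  mul_range e := by
    simp only [AddMonoidAlgebra.single_mul_single, ← Unitization.inr_mul, edge_mul_vertex, add_zero]
  range_mul e := by
    simp only [AddMonoidAlgebra.single_mul_single, ← Unitization.inr_mul, vertex_mul_ghost, zero_add]
  mul_source e := by
    simp only [AddMonoidAlgebra.single_mul_single, ← Unitization.inr_mul, ghost_mul_vertex, add_zero]
  ghost_mul_self e := by
    simp only [AddMonoidAlgebra.single_mul_single, ← Unitization.inr_mul, ghost_mul_edge_self,
      neg_add_cancel]
  ghost_mul_ne e f h := by
    simp only [AddMonoidAlgebra.single_mul_single, ← Unitization.inr_mul, ghost_mul_edge_of_ne h,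
      Unitization.inr_zero, AddMonoidAlgebra.single_zero]
  vertex_eq_sum v hne hfin := by
    simp only [AddMonoidAlgebra.single_mul_single, ← Unitization.inr_mul, add_neg_cancel]
    rw [(isLeavittFamily R E).vertex_eq_sum v hne hfin]
    have key : ∀ s : Finset A, (AddMonoidAlgebra.single (0 : ℤ)
        ((∑ e ∈ s, edge R E e * ghost R E e : LeavittPathAlgebra R E) :
          Unitization R (LeavittPathAlgebra R E))) =
        ∑ e ∈ s, AddMonoidAlgebra.single 0 ((edge R E e * ghost R E e : LeavittPathAlgebra R E) :
          Unitization R (LeavittPathAlgebra R E)) := by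
      classical
      intro s
      induction s using Finset.induction_on with
      | empty => simp
      | insert e s he ih =>
        rw [Finset.sum_insert he, Finset.sum_insert he, Unitization.inr_add,
          AddMonoidAlgebra.single_add, ih]
    exact key _

/-- The coaction which sends a homogeneous element `x` of degree `k` to the monomial `x tᵏ`. -/
noncomputable def coaction (R : Type*) {V A : Type*} [CommRing R] (E : DirectedGraph V A) :
    LeavittPathAlgebra R E →ₙₐ[R] AddMonoidAlgebra (Unitization R (LeavittPathAlgebra R E)) ℤ :=
  (existsUnique_lift (isLeavittFamily_single R E)).choose

theorem coaction_vertex (v : V) : coaction R E (vertex R E v) = .single 0 ↑(vertex R E v) :=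
  (existsUnique_lift (isLeavittFamily_single R E)).choose_spec.1.1 v

theorem coaction_edge (e : A) : coaction R E (edge R E e) = .single 1 ↑(edge R E e) :=
  (existsUnique_lift (isLeavittFamily_single R E)).choose_spec.1.2.1 e

theorem coaction_ghost (e : A) : coaction R E (ghost R E e) = .single (-1) ↑(ghost R E e) :=
  (existsUnique_lift (isLeavittFamily_single R E)).choose_spec.1.2.2 e

theorem coaction_pathProd (v : V) (l : List A) :
    coaction R E (pathProd R E v l) = .single (l.length : ℤ) ↑(pathProd R E v l) := by
  induction l generalizing v with
  | nil => exact coaction_vertex v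
  | cons e l ih =>
    rw [pathProd, map_mul, ih, coaction_edge, AddMonoidAlgebra.single_mul_single,
      ← Unitization.inr_mul]
    congr 1
    simp [add_comm]

theorem coaction_ghostProd (v : V) (l : List A) :
    coaction R E (ghostProd R E v l) = .single (-(l.length : ℤ)) ↑(ghostProd R E v l) := by
  induction l generalizing v with
  | nil => exact coaction_vertex v
  | cons e l ih =>
    rw [ghostProd, map_mul, ih, coaction_ghost, AddMonoidAlgebra.single_mul_single,
      ← Unitization.inr_mul]
    congr 1
    simp [add_comm]

theorem coaction_of_mem {k : ℤ} {x : LeavittPathAlgebra R E} (hx : x ∈ component R E k) :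
    coaction R E x = .single k ↑x := by
  induction hx using Submodule.span_induction with
  | mem x hx =>
    obtain ⟨α, β, rfl, rfl⟩ := hx
    rw [map_mul, ofPath, ofPathStar, coaction_pathProd, coaction_ghostProd,
      AddMonoidAlgebra.single_mul_single, ← Unitization.inr_mul]
    rfl
  | zero => simp
  | add x y _ _ hx hy => rw [map_add, hx, hy, Unitization.inr_add, AddMonoidAlgebra.single_add]
  | smul r x _ hx => rw [map_smul, hx, Unitization.inr_smul, AddMonoidAlgebra.smul_single]

/-- The coefficient of degree `k` of an element. -/
noncomputable def degreeCoeff (k : ℤ) :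
    LeavittPathAlgebra R E →+ Unitization R (LeavittPathAlgebra R E) where
  toFun x := (coaction R E x).coeff k
  map_zero' := by simp
  map_add' x y := by simp

theorem degreeCoeff_of_mem {k j : ℤ} {x : LeavittPathAlgebra R E} (hx : x ∈ component R E j) :
    degreeCoeff k x = if j = k then ↑x else 0 := by
  change (coaction R E x).coeff k = _
  rw [coaction_of_mem hx, AddMonoidAlgebra.coeff_single, Finsupp.single_apply]

theorem exists_sum_components (x : LeavittPathAlgebra R E) :
    ∃ f : ℤ →₀ LeavittPathAlgebra R E, (∀ k, f k ∈ component R E k) ∧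
      ∑ k ∈ f.support, f k = x := by
  have : (⨆ k, component R E k) = ⊤ := by
    rw [eq_top_iff, ← span_monomials, Submodule.span_le]
    rintro _ ⟨α, β, rfl⟩
    exact Submodule.mem_iSup_of_mem _ (Submodule.subset_span ⟨α, β, rfl, rfl⟩)
  obtain ⟨f, hf, h⟩ := (Submodule.mem_iSup_iff_exists_finsupp _ x).1
    (this ▸ Submodule.mem_top : x ∈ ⨆ k, component R E k)
  exact ⟨f, hf, h⟩

theorem degreeCoeff_sum (f : ℤ →₀ LeavittPathAlgebra R E) (hf : ∀ k, f k ∈ component R E k)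
    (k : ℤ) : degreeCoeff k (∑ j ∈ f.support, f j) = ↑(f k) := by
  rw [map_sum, Finset.sum_congr rfl fun j _ => degreeCoeff_of_mem (hf j), Finset.sum_ite_eq']
  split_ifs with h
  · rfl
  · rw [Finsupp.notMem_support_iff.1 h, Unitization.inr_zero]

/-- For the converse, write x as a sum of homogeneous parts and compare the coefficients of degree
k. Homogeneity thus becomes an equation that is compatible with products. -/
theorem mem_component_iff {k : ℤ} {x : LeavittPathAlgebra R E} :
    x ∈ component R E k ↔ coaction R E x = .single k ↑x := by
  refine ⟨coaction_of_mem, fun h => ?_⟩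
  obtain ⟨f, hf, rfl⟩ := exists_sum_components x
  have h' := degreeCoeff_sum f hf k
  change (coaction R E _).coeff k = _ at h'
  rw [h, AddMonoidAlgebra.coeff_single, Finsupp.single_eq_same] at h'
  rw [Unitization.inr_injective h']
  exact hf k

theorem mul_mem_component {j k : ℤ} {x y : LeavittPathAlgebra R E} (hx : x ∈ component R E j)
    (hy : y ∈ component R E k) : x * y ∈ component R E (j + k) := by
  rw [mem_component_iff, map_mul, coaction_of_mem hx, coaction_of_mem hy,
    AddMonoidAlgebra.single_mul_single, Unitization.inr_mul]

theorem vertex_mem_component (v : V) : vertex R E v ∈ component R E 0 :=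
  mem_component_iff.2 (coaction_vertex v)

theorem pathProd_mem_component (v : V) (l : List A) :
    pathProd R E v l ∈ component R E l.length :=
  mem_component_iff.2 (coaction_pathProd v l)

theorem gap_mem_component (v : V) (F : Finset A) : gap R E v F ∈ component R E 0 :=
  Submodule.sub_mem _ (vertex_mem_component v) <| Submodule.sum_mem _ fun e _ => by
    simpa using mul_mem_component (mem_component_iff.2 (coaction_edge (R := R) e))
      (mem_component_iff.2 (coaction_ghost e))

theorem iSupIndep_idealComponent (I : TwoSidedIdeal (LeavittPathAlgebra R E)) :
    iSupIndep (idealComponent I) := by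
  intro k
  rw [AddSubgroup.disjoint_def]
  intro x hx hx'
  have hle : (⨆ (j) (_ : j ≠ k), idealComponent I j) ≤ (degreeCoeff (R := R) (E := E) k).ker :=
    iSup₂_le fun j hj y hy => by
      rw [AddMonoidHom.mem_ker, degreeCoeff_of_mem hy.2, if_neg hj]
  have := hle hx'
  rw [AddMonoidHom.mem_ker, degreeCoeff_of_mem hx.2, if_pos rfl] at this
  exact Unitization.inr_injective (this.trans (Unitization.inr_zero _).symm)

theorem exists_degreeCoeff_eq {I : TwoSidedIdeal (LeavittPathAlgebra R E)} (hI : IsGradedIdeal I)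
    {x : LeavittPathAlgebra R E} (hx : x ∈ I) (k : ℤ) : ∃ y ∈ I, degreeCoeff k x = ↑y := by
  have hx' : x ∈ ⨆ k : ℤ, idealComponent I k := hI.2.symm ▸ hx
  clear hx
  induction hx' using AddSubgroup.iSup_induction' with
  | hp j x hx =>
    rw [degreeCoeff_of_mem hx.2]
    split_ifs
    · exact ⟨x, hx.1, rfl⟩
    · exact ⟨0, I.zero_mem, (Unitization.inr_zero _).symm⟩
  | h1 => exact ⟨0, I.zero_mem, by simp⟩
  | hadd x y _ _ ihx ihy =>
    obtain ⟨a, ha, ha'⟩ := ihx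
    obtain ⟨b, hb, hb'⟩ := ihy
    exact ⟨a + b, I.add_mem ha hb, by rw [map_add, ha', hb', Unitization.inr_add]⟩

/-- In a graded ideal, the degree zero part of an element of the ideal is in the ideal. -/
theorem vertex_mem_of_sub_mem {I : TwoSidedIdeal (LeavittPathAlgebra R E)} (hI : IsGradedIdeal I)
    {v : V} {l : List A} (hl : l ≠ []) (h : vertex R E v - pathProd R E v l ∈ I) :
    vertex R E v ∈ I := by
  obtain ⟨y, hy, hxy⟩ := exists_degreeCoeff_eq hI h 0
  rw [map_sub, degreeCoeff_of_mem (vertex_mem_component v),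
    degreeCoeff_of_mem (pathProd_mem_component v l), if_pos rfl, if_neg (by simpa using hl),
    sub_zero] at hxy
  exact Unitization.inr_injective hxy ▸ hy

/-- An ideal generated by homogeneous elements is graded. -/
theorem isGradedIdeal_span {s : Set (LeavittPathAlgebra R E)}
    (hs : ∀ x ∈ s, ∃ k, x ∈ component R E k) : IsGradedIdeal (TwoSidedIdeal.span s) := by
  set I := TwoSidedIdeal.span s with hI
  refine ⟨iSupIndep_idealComponent _, le_antisymm (iSup_le fun k => inf_le_left) ?_⟩
  set D := ⨆ k : ℤ, idealComponent I k with hD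
  have left : ∀ x y, y ∈ D → x * y ∈ D := by
    intro x y hy
    obtain ⟨f, hf, rfl⟩ := exists_sum_components x
    rw [Finset.sum_mul]
    refine sum_mem fun j _ => ?_
    have : D ≤ D.comap (AddMonoidHom.mulLeft (f j)) := by
      conv_lhs => rw [hD]
      exact iSup_le fun k z hz => AddSubgroup.mem_iSup_of_mem (j + k)
        ⟨TwoSidedIdeal.mul_mem_left _ _ _ hz.1, mul_mem_component (hf j) hz.2⟩
    exact this hy
  have right : ∀ x y, x ∈ D → x * y ∈ D := by
    intro y x hy
    obtain ⟨f, hf, rfl⟩ := exists_sum_components x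
    rw [Finset.mul_sum]
    refine sum_mem fun j _ => ?_
    have : D ≤ D.comap (AddMonoidHom.mulRight (f j)) := by
      conv_lhs => rw [hD]
      exact iSup_le fun k z hz => AddSubgroup.mem_iSup_of_mem (k + j)
        ⟨TwoSidedIdeal.mul_mem_right _ _ _ hz.1, mul_mem_component hz.2 (hf j)⟩
    exact this hy
  -- The sum of the homogeneous parts of `I` is itself an ideal; it contains the generators, hence
  -- `I`.
  let J : TwoSidedIdeal (LeavittPathAlgebra R E) :=
    .mk' D D.zero_mem D.add_mem D.neg_mem (left _ _) (right _ _)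
  have hJ : ∀ x, x ∈ J ↔ x ∈ D := fun x => by simp [J, TwoSidedIdeal.mem_mk']
  have : I ≤ J := TwoSidedIdeal.span_le.2 fun x hx => by
    obtain ⟨k, hk⟩ := hs x hx
    exact (hJ x).2 (AddSubgroup.mem_iSup_of_mem k ⟨TwoSidedIdeal.subset_span hx, hk⟩)
  exact fun x hx => (hJ x).1 (this hx)

theorem isGradedIdeal_idealOfPair (P : E.AdmissiblePair) : IsGradedIdeal (idealOfPair R P) :=
  isGradedIdeal_span <| by
    rintro _ (⟨v, _, rfl⟩ | ⟨v, _, rfl⟩)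
    · exact ⟨0, vertex_mem_component v⟩
    · exact ⟨0, gap_mem_component v _⟩

end LeavittPathAlgebra

namespace LeavittPathAlgebra

variable {R V A : Type*} [CommRing R] {E : DirectedGraph V A}

/-! ### Reduction of elements to scalar multiples of vertices -/

/-- The span of the paths with range `w`. -/
noncomputable def pathSpan (R : Type*) {V A : Type*} [CommRing R] (E : DirectedGraph V A) (w : V) :
    Submodule R (LeavittPathAlgebra R E) :=
  Submodule.span R (ofPath R '' {α : E.Path | α.finish = w})

/-- Sums of at most `n` scalar multiples of closed paths based at `w`. -/
inductive IsCycleSum (w : V) : ℕ → LeavittPathAlgebra R E → Prop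
  | zero (n : ℕ) : IsCycleSum w n 0
  | add {n : ℕ} {l : List A} {x : LeavittPathAlgebra R E} (r : R) : E.IsWalkFrom w l →
      E.endOf w l = w → l ≠ [] → IsCycleSum w n x →
      IsCycleSum w (n + 1) (r • pathProd R E w l + x)

theorem IsCycleSum.succ {w : V} {n : ℕ} {x : LeavittPathAlgebra R E} (h : IsCycleSum w n x) :
    IsCycleSum w (n + 1) x := by
  induction h with
  | zero n => exact .zero _
  | add r h₁ h₂ h₃ _ ih => exact .add r h₁ h₂ h₃ ih

/-- For a closed path l, the product m*lm is 0 unless lm = mt, and then it is t, a closed path at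
the end of m of the same positive length as l. -/
theorem IsCycleSum.conj {w : V} {n : ℕ} {x : LeavittPathAlgebra R E} (h : IsCycleSum w n x)
    {m : List A} (hm : E.IsWalkFrom w m) :
    IsCycleSum (E.endOf w m) n (ghostProd R E w m * x * pathProd R E w m) := by
  induction h with
  | zero n => simpa using IsCycleSum.zero n
  | @add n l x r h₁ h₂ h₃ _ ih =>
    have hlen : 0 < l.length := List.length_pos_iff.2 h₃
    have hlm : E.IsWalkFrom w (l ++ m) := DirectedGraph.isWalkFrom_append.2 ⟨h₁, h₂.symm ▸ hm⟩
    have hend : E.endOf w (l ++ m) = E.endOf w m := by rw [DirectedGraph.endOf_append, h₂]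
    rw [mul_add, add_mul, mul_smul_comm, smul_mul_assoc,
      mul_assoc (ghostProd R E w m) (pathProd _ _ _ _)]
    have happ := pathProd_append (R := R) w l m (h₂.symm ▸ hm)
    rw [h₂] at happ
    rw [← happ]
    by_cases hp : m <+: l ++ m
    · obtain ⟨t, ht⟩ := hp
      rw [← ht] at hlm hend ⊢
      rw [ghostProd_mul_pathProd_append hlm]
      rw [DirectedGraph.isWalkFrom_append] at hlm
      rw [DirectedGraph.endOf_append] at hend
      refine .add r hlm.2 hend ?_ ih
      rintro rfl
      have := congrArg List.length ht
      simp only [List.append_nil, List.length_append] at this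
      omega
    · rw [ghostProd_mul_pathProd_of_incomparable hp, smul_zero, zero_add]
      · exact ih.succ
      · intro h
        have := h.length_le
        rw [List.length_append] at this
        omega

/-- Condition (K) yields a closed path at `w` which is not a prefix of a given one. -/
theorem exists_closed_ghostProd_mul_eq_zero (hK : E.ConditionK) {w : V} {l : List A}
    (hl : E.IsWalkFrom w l) (he : E.endOf w l = w) (hne : l ≠ []) :
    ∃ d, E.IsWalkFrom w d ∧ E.endOf w d = w ∧
      ghostProd R E w d * pathProd R E w l = 0 := by
  rcases hK w with h | ⟨α, β, hne', hα, hβ⟩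
  · exact absurd ⟨⟨w, l, hl⟩, List.length_pos_iff.2 hne, rfl, he⟩ h
  have key : ∀ γ : E.Path, γ.IsClosedSimpleAt w →
      ghostProd R E w γ.edges * pathProd R E w l = 0 ∨ γ.edges <+: l := fun γ hγ => by
    by_cases h₁ : γ.edges <+: l
    · exact Or.inr h₁
    by_cases h₂ : l <+: γ.edges
    · exact Or.inr (hγ.eq_of_prefix h₂ hne he ▸ List.prefix_rfl)
    · exact Or.inl (ghostProd_mul_pathProd_of_incomparable h₁ h₂)
  have closed : ∀ γ : E.Path, γ.IsClosedSimpleAt w → E.IsWalkFrom w γ.edges ∧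
      E.endOf w γ.edges = w ∧ γ.edges ≠ [] := fun γ hγ => by
    have h₁ := γ.isWalk
    have h₂ := hγ.1.2.2
    rw [DirectedGraph.Path.finish] at h₂
    rw [hγ.1.2.1] at h₁ h₂
    exact ⟨h₁, h₂, List.length_pos_iff.1 hγ.1.1⟩
  have hα' := closed α hα
  have hβ' := closed β hβ
  rcases key α hα with h | h₁
  · exact ⟨_, hα'.1, hα'.2.1, h⟩
  rcases key β hβ with h | h₂
  · exact ⟨_, hβ'.1, hβ'.2.1, h⟩
  refine absurd (DirectedGraph.Path.ext (hα.1.2.1.trans hβ.1.2.1.symm) ?_) hne'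
  -- Two prefixes of `l` are comparable, and a closed simple path has no shorter nonempty closed
  -- prefix; so both being prefixes would make them equal.
  rcases List.prefix_or_prefix_of_prefix h₁ h₂ with h | h
  · exact hβ.eq_of_prefix h hα'.2.2 hα'.2.1
  · exact (hα.eq_of_prefix h hβ'.2.2 hβ'.2.1).symm

/-- Conjugation by a closed path d with d*l = 0 removes the leading term l, fixes r•w, and leaves a
cycle sum with a smaller bound on its number of terms. -/
theorem IsCycleSum.exists_mul_mul_eq (hK : E.ConditionK) {w : V} {n : ℕ}
    {x : LeavittPathAlgebra R E} (h : IsCycleSum w n x) (r : R) :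
    ∃ a b, a * (r • vertex R E w + x) * b = r • vertex R E w := by
  induction n generalizing x with
  | zero =>
    cases h
    exact ⟨vertex R E w, vertex R E w, by
      simp only [add_zero, mul_smul_comm, smul_mul_assoc, vertex_mul_self]⟩
  | succ n ih =>
    cases h with
    | zero => exact ⟨vertex R E w, vertex R E w, by
      simp only [add_zero, mul_smul_comm, smul_mul_assoc, vertex_mul_self]⟩
    | @add _ l x t h₁ h₂ h₃ hx =>
      obtain ⟨d, hd, hd', hdl⟩ := exists_closed_ghostProd_mul_eq_zero (R := R) hK h₁ h₂ h₃
      have hc := hx.conj hd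
      rw [hd'] at hc
      obtain ⟨a, b, hab⟩ := ih hc
      refine ⟨a * ghostProd R E w d, pathProd R E w d * b, ?_⟩
      have : ghostProd R E w d * (r • vertex R E w + (t • pathProd R E w l + x)) *
          pathProd R E w d =
          r • vertex R E w + ghostProd R E w d * x * pathProd R E w d := by
        rw [mul_add, mul_add, mul_smul_comm, mul_smul_comm, hdl, smul_zero, zero_add,
          ghostProd_mul_vertex hd, add_mul, smul_mul_assoc, ghostProd_mul_pathProd_self hd, hd']
      rw [← this] at hab
      simpa only [mul_assoc] using hab

theorem exists_mul_eq_vertex_add_cycleSum {w : V} {p : LeavittPathAlgebra R E}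
    (hp : p ∈ pathSpan R E w) (h0 : p ≠ 0) :
    ∃ (a : LeavittPathAlgebra R E) (r : R) (n : ℕ) (y : LeavittPathAlgebra R E),
      r ≠ 0 ∧ IsCycleSum w n y ∧ a * p = r • vertex R E w + y := by
  classical
  obtain ⟨c, hc, rfl⟩ := (Finsupp.mem_span_image_iff_linearCombination R).1 hp
  have hne : c.support.Nonempty := by
    rw [Finsupp.support_nonempty_iff]
    rintro rfl
    exact h0 (map_zero _)
  -- Minimal length prevents any other β in the support from being a proper prefix of α, so α*β is 0
  -- or a closed path of positive length at `w`.
  obtain ⟨α, hα, hmin⟩ := Finset.exists_min_image c.support (fun α => α.edges.length) hne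
  have hend : ∀ β ∈ c.support, E.endOf β.start β.edges = w := fun β hβ => hc hβ
  have key : ∀ s : Finset E.Path, s ⊆ c.support.erase α →
      IsCycleSum w s.card (∑ β ∈ s, c β • (ofPathStar R α * ofPath R β)) := by
    intro s
    induction s using Finset.induction_on with
    | empty => exact fun _ => .zero _
    | insert β s hβs ih =>
      intro hs
      have hβ := hs (Finset.mem_insert_self β s)
      rw [Finset.mem_erase] at hβ
      replace ih := ih fun x hx => hs (Finset.mem_insert_of_mem hx)
      rw [Finset.sum_insert hβs, Finset.card_insert_of_notMem hβs]
      by_cases hst : α.start = β.start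
      · have hw := β.isWalk
        have he := hend β hβ.2
        have hle := hmin β hβ.2
        rw [ofPath, ofPathStar]
        rw [← hst] at hw he ⊢
        by_cases hpre : α.edges <+: β.edges
        · obtain ⟨t, ht⟩ := hpre
          rw [← ht] at hw he ⊢
          rw [ghostProd_mul_pathProd_append hw, hend α hα]
          rw [DirectedGraph.isWalkFrom_append, hend α hα] at hw
          rw [DirectedGraph.endOf_append, hend α hα] at he
          refine .add _ hw.2 he ?_ ih
          rintro rfl
          exact hβ.1 (DirectedGraph.Path.ext hst.symm (by simpa using ht.symm))
        · rw [ghostProd_mul_pathProd_of_incomparable hpre, smul_zero, zero_add]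
          · exact ih.succ
          · exact fun h => hpre (h.eq_of_length_le hle ▸ List.prefix_rfl)
      · rw [ofPath, ofPathStar, ghostProd_mul_pathProd_of_ne α.isWalk β.isWalk hst, smul_zero,
          zero_add]
        exact ih.succ
  refine ⟨ofPathStar R α, c α, _, _, Finsupp.mem_support_iff.1 hα, key _ subset_rfl, ?_⟩
  rw [Finsupp.linearCombination_apply, Finsupp.sum, Finset.mul_sum]
  simp only [mul_smul_comm]
  rw [← Finset.add_sum_erase _ _ hα]
  congr 2
  rw [ofPath, ofPathStar, ghostProd_mul_pathProd_self α.isWalk, hend α hα]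

theorem exists_mul_pathProd_mul_eq_smul_vertex (hK : E.ConditionK) {w : V}
    {p : LeavittPathAlgebra R E} (hp : p ∈ pathSpan R E w) (h0 : p ≠ 0) {m : List A}
    (hm : E.IsWalkFrom w m) :
    ∃ (a b : LeavittPathAlgebra R E) (r : R),
      r ≠ 0 ∧ a * (p * pathProd R E w m) * b = r • vertex R E (E.endOf w m) := by
  obtain ⟨a, r, n, y, hr, hy, hay⟩ := exists_mul_eq_vertex_add_cycleSum hp h0
  obtain ⟨a', b, hab⟩ := (hy.conj hm).exists_mul_mul_eq hK r
  refine ⟨a' * (ghostProd R E w m * a), b, r, hr, ?_⟩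
  rw [← hab, mul_assoc a', mul_assoc (ghostProd R E w m), ← mul_assoc a, hay, add_mul, mul_add,
    smul_mul_assoc, vertex_mul_pathProd hm, mul_smul_comm, ghostProd_mul_pathProd_self hm,
    mul_assoc (ghostProd R E w m)]

/-- Condition (K) is not needed: a closed path at w ∉ H never enters the hereditary set H, so its
first edge is in F and is killed by the gap on its left. -/
theorem exists_mul_gap_eq_smul_gap {H : Set V} (hH : E.Hereditary H) {w : V} (hw : w ∉ H)
    {F : Finset A} (hF : ∀ e ∈ F, E.source e = w) (hF' : ∀ e ∈ E.emittedOutside H w, e ∈ F)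
    {p : LeavittPathAlgebra R E} (hp : p ∈ pathSpan R E w) (h0 : p ≠ 0) :
    ∃ (a : LeavittPathAlgebra R E) (r : R), r ≠ 0 ∧ a * (p * gap R E w F) = r • gap R E w F := by
  obtain ⟨a, r, n, y, hr, hy, hay⟩ := exists_mul_eq_vertex_add_cycleSum hp h0
  have hgy : gap R E w F * y = 0 := by
    clear hay
    induction hy with
    | zero => exact mul_zero _
    | @add n l x t h₁ h₂ h₃ _ ih =>
      rw [mul_add, ih, add_zero, mul_smul_comm]
      cases l with
      | nil => exact absurd rfl h₃
      | cons e l =>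
        have he : e ∈ F := hF' e ⟨h₁.1, fun h => hw (h₂ ▸ hH.endOf_mem (l := l) h₁.2 h)⟩
        rw [pathProd, ← mul_assoc, gap_mul_edge he h₁.1, zero_mul, smul_zero]
  refine ⟨gap R E w F * a, r, hr, ?_⟩
  rw [mul_assoc, ← mul_assoc a, hay, ← mul_assoc, mul_add, hgy, add_zero, mul_smul_comm,
    gap_mul_vertex hF, smul_mul_assoc, gap_mul_gap hF]

/-! ### The filtration by the length of ghost paths -/

theorem ghost_mul_gap {v : V} {F : Finset A} {e : A} (he : e ∈ F) (hv : E.source e = v) :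
    ghost R E e * gap R E v F = 0 := by
  rw [gap, mul_sub, ghost_mul_vertex hv, Finset.mul_sum, Finset.sum_eq_single e, ← mul_assoc,
    ghost_mul_edge_self, vertex_mul_ghost rfl, sub_self]
  · intro f _ hf
    rw [← mul_assoc, ghost_mul_edge_of_ne hf.symm, zero_mul]
  · exact fun h => absurd he h

theorem mul_vertex_of_mem_pathSpan {w : V} {p : LeavittPathAlgebra R E}
    (hp : p ∈ pathSpan R E w) : p * vertex R E w = p := by
  induction hp using Submodule.span_induction with
  | mem x hx =>
    obtain ⟨α, rfl, rfl⟩ := hx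
    exact pathProd_mul_vertex _ _
  | zero => exact zero_mul _
  | add x y _ _ hx hy => rw [add_mul, hx, hy]
  | smul r x _ hx => rw [smul_mul_assoc, hx]

theorem mul_edge_mem_pathSpan {w : V} {p : LeavittPathAlgebra R E} (hp : p ∈ pathSpan R E w)
    {e : A} (he : E.source e = w) : p * edge R E e ∈ pathSpan R E (E.range e) := by
  induction hp using Submodule.span_induction with
  | mem x hx =>
    obtain ⟨α, rfl, rfl⟩ := hx
    have hw : E.IsWalkFrom α.start (α.edges ++ [e]) :=
      DirectedGraph.isWalkFrom_append.2 ⟨α.isWalk, he, trivial⟩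
    refine Submodule.subset_span ⟨⟨α.start, α.edges ++ [e], hw⟩, ?_, ?_⟩
    · exact DirectedGraph.endOf_append _ _ _
    · exact (pathProd_mul_edge _ _ he).symm
  | zero => rw [zero_mul]; exact Submodule.zero_mem _
  | add x y _ _ hx hy => rw [add_mul]; exact Submodule.add_mem _ hx hy
  | smul r x _ hx => rw [smul_mul_assoc]; exact Submodule.smul_mem _ _ hx

/-- The span of the elements `αβ*` with `β` a path of length at most `n` and source `w`. -/
noncomputable def ghostFiltration (R : Type*) {V A : Type*} [CommRing R] (E : DirectedGraph V A) :
    ℕ → V → Submodule R (LeavittPathAlgebra R E)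
  | 0, w => pathSpan R E w
  | n + 1, w => pathSpan R E w ⊔ ⨆ e : {e // E.source e = w},
      (ghostFiltration R E n (E.range e)).map (LinearMap.mulRight R (ghost R E e.1))

theorem pathSpan_le_ghostFiltration (n : ℕ) (w : V) :
    pathSpan R E w ≤ ghostFiltration R E n w := by
  cases n with
  | zero => exact le_rfl
  | succ n => exact le_sup_left

theorem ghostFiltration_mono (w : V) : Monotone fun n => ghostFiltration R E n w := by
  refine monotone_nat_of_le_succ fun n => ?_
  induction n generalizing w with
  | zero => exact le_sup_left
  | succ n ih => exact sup_le_sup_left (iSup_mono fun e => Submodule.map_mono (ih _)) _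

theorem mul_ghost_mem_ghostFiltration {n : ℕ} {e : A} {x : LeavittPathAlgebra R E}
    (hx : x ∈ ghostFiltration R E n (E.range e)) :
    x * ghost R E e ∈ ghostFiltration R E (n + 1) (E.source e) :=
  Submodule.mem_sup_right <| Submodule.mem_iSup_of_mem ⟨e, rfl⟩ ⟨x, hx, rfl⟩

theorem mul_vertex_of_mem_ghostFiltration {n : ℕ} {w : V} {x : LeavittPathAlgebra R E}
    (hx : x ∈ ghostFiltration R E n w) : x * vertex R E w = x := by
  have key : ghostFiltration R E n w ≤
      LinearMap.ker (LinearMap.mulRight R (vertex R E w) - LinearMap.id) := by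
    have hp : pathSpan R E w ≤
        LinearMap.ker (LinearMap.mulRight R (vertex R E w) - LinearMap.id) := fun x hx => by
      simp [mul_vertex_of_mem_pathSpan hx]
    cases n with
    | zero => exact hp
    | succ n =>
      refine sup_le hp (iSup_le fun e => ?_)
      rintro _ ⟨y, -, rfl⟩
      simp [mul_assoc, ghost_mul_vertex e.2]
  simpa [sub_eq_zero] using key hx

theorem pathProd_mul_ghostProd_mem (v w : V) (l m : List A) (hl : E.IsWalkFrom v l)
    (hm : E.IsWalkFrom w m) :
    pathProd R E v l * ghostProd R E w m ∈ ghostFiltration R E m.length w := by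
  induction m generalizing w with
  | nil =>
    by_cases h : E.endOf v l = w
    · subst h
      rw [ghostProd, pathProd_mul_vertex]
      exact Submodule.subset_span ⟨⟨v, l, hl⟩, rfl, rfl⟩
    · rw [ghostProd, ← pathProd_mul_vertex, mul_assoc, vertex_mul_of_ne h, mul_zero]
      exact Submodule.zero_mem _
  | cons e m ih =>
    obtain ⟨rfl, hm⟩ := hm
    rw [ghostProd, ← mul_assoc]
    exact mul_ghost_mem_ghostFiltration (ih _ hm)

theorem exists_mul_vertex_mem_ghostFiltration (x : LeavittPathAlgebra R E) (w : V) :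
    ∃ n, x * vertex R E w ∈ ghostFiltration R E n w := by
  have hx : x ∈ Submodule.span R {x : LeavittPathAlgebra R E | ∃ α β : E.Path,
    x = ofPath R α * ofPathStar R β} := span_monomials (R := R) (E := E) ▸ Submodule.mem_top
  induction hx using Submodule.span_induction with
  | mem x hx =>
    obtain ⟨α, β, rfl⟩ := hx
    rw [mul_assoc, ofPath, ofPathStar]
    refine ⟨β.edges.length, ?_⟩
    by_cases h : β.start = w
    · subst h
      rw [ghostProd_mul_vertex β.isWalk]
      exact pathProd_mul_ghostProd_mem _ _ _ _ α.isWalk β.isWalk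
    · rw [← ghostProd_mul_vertex β.isWalk, mul_assoc, vertex_mul_of_ne h, mul_zero, mul_zero]
      exact Submodule.zero_mem _
  | zero => exact ⟨0, by simp⟩
  | add x y _ _ hx hy =>
    obtain ⟨n, hn⟩ := hx
    obtain ⟨k, hk⟩ := hy
    refine ⟨max n k, ?_⟩
    rw [add_mul]
    exact Submodule.add_mem _ (ghostFiltration_mono w (le_max_left n k) hn)
      (ghostFiltration_mono w (le_max_right n k) hk)
  | smul r x _ hx =>
    obtain ⟨n, hn⟩ := hx
    exact ⟨n, by rw [smul_mul_assoc]; exact Submodule.smul_mem _ _ hn⟩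

theorem exists_decomposition_of_mem_ghostFiltration_succ {n : ℕ} {w : V}
    {x : LeavittPathAlgebra R E} (hx : x ∈ ghostFiltration R E (n + 1) w) :
    ∃ p ∈ pathSpan R E w, ∃ (F : Finset A) (y : A → LeavittPathAlgebra R E),
      (∀ e ∈ F, E.source e = w ∧ y e ∈ ghostFiltration R E n (E.range e)) ∧
        x = p + ∑ e ∈ F, y e * ghost R E e := by
  classical
  obtain ⟨p, hp, z, hz, rfl⟩ := Submodule.mem_sup.1 hx
  obtain ⟨f, hf, rfl⟩ := (Submodule.mem_iSup_iff_exists_finsupp _ _).1 hz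
  choose y hy hyf using hf
  refine ⟨p, hp, f.support.map (.subtype _), fun e => if h : E.source e = w then y ⟨e, h⟩ else 0,
    fun e he => ?_, ?_⟩
  · obtain ⟨e, he, rfl⟩ := Finset.mem_map.1 he
    refine ⟨e.2, ?_⟩
    have hye := hy e
    rwa [← show (if h : E.source e.1 = w then y ⟨e, h⟩ else 0) = y e from dif_pos e.2] at hye
  · rw [Finset.sum_map]
    congr 1
    refine Finset.sum_congr rfl fun e _ => ?_
    have hye := (hyf e).symm
    rwa [← show (if h : E.source e.1 = w then y ⟨e, h⟩ else 0) = y e from dif_pos e.2] at hye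

/-! ### Reduction modulo I(H, S) -/

/-- The vertices outside `H` and the elements `v^H` with `v ∈ B_H \ S`. -/
def IsReducedElement (P : E.AdmissiblePair) (q : LeavittPathAlgebra R E) : Prop :=
  (∃ w ∉ P.H, q = vertex R E w) ∨
    ∃ (w : V) (hw : w ∈ E.breaking P.H), w ∉ P.S ∧ q = breakingElement R E P.H w hw

theorem notMem_of_mul_vertex {P : E.AdmissiblePair} {w : V} {x : LeavittPathAlgebra R E}
    (hx : x * vertex R E w = x) (hxJ : x ∉ idealOfPair R P) : w ∉ P.H := fun h => hxJ <| by
  rw [← hx]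
  exact TwoSidedIdeal.mul_mem_left _ _ _ (P.vertex_mem_idealOfPair h)

theorem exists_reduced_of_sub_mem (hK : E.ConditionK) (P : E.AdmissiblePair) {w : V} (hw : w ∉ P.H)
    {x p : LeavittPathAlgebra R E} (hp : p ∈ pathSpan R E w) (h0 : p ≠ 0)
    (hxp : x - p ∈ idealOfPair R P) :
    ∃ (a b : LeavittPathAlgebra R E) (r : R) (q : LeavittPathAlgebra R E),
      r ≠ 0 ∧ IsReducedElement P q ∧ a * x * b - r • q ∈ idealOfPair R P := by
  obtain ⟨a, b, r, hr, hab⟩ :=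
    exists_mul_pathProd_mul_eq_smul_vertex hK hp h0 (m := []) trivial
  rw [pathProd, mul_vertex_of_mem_pathSpan hp] at hab
  refine ⟨a, b, r, vertex R E w, hr, Or.inl ⟨w, hw, rfl⟩, ?_⟩
  change _ = r • vertex R E w at hab
  rw [← hab, ← sub_mul, ← mul_sub]
  exact TwoSidedIdeal.mul_mem_right _ _ _ (TwoSidedIdeal.mul_mem_left _ _ _ hxp)

/-- This is the terminal case of the reduction, where no edge can be multiplied on without falling
into the ideal. It suffices that p ≠ 0 in the algebra itself; nothing about p modulo the ideal is
needed. -/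
theorem exists_reduced_of_mul_gap [Countable A] [Nontrivial R] (hK : E.ConditionK)
    (P : E.AdmissiblePair) {w : V} {x p : LeavittPathAlgebra R E} {F : Finset A}
    (hF : ∀ e ∈ F, E.source e = w) (hp : p ∈ pathSpan R E w) (hxw : x * vertex R E w = x)
    (hxJ : x ∉ idealOfPair R P) (hxe : ∀ e, E.source e = w → x * edge R E e ∈ idealOfPair R P)
    (hxp : x - p * gap R E w F ∈ idealOfPair R P) :
    ∃ (a b : LeavittPathAlgebra R E) (r : R) (q : LeavittPathAlgebra R E),
      r ≠ 0 ∧ IsReducedElement P q ∧ a * x * b - r • q ∈ idealOfPair R P := by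
  have hw := notMem_of_mul_vertex hxw hxJ
  have h0 : p ≠ 0 := by
    rintro rfl
    rw [zero_mul, sub_zero] at hxp
    exact hxJ hxp
  have hsub : ∀ e ∈ E.emittedOutside P.H w, e ∈ F := by
    rintro e ⟨he, her⟩
    -- If `e` were missing from `F`, then pe would lie in the ideal and reduce to a nonzero multiple
    -- of r(e), forcing r(e) ∈ H.
    by_contra heF
    obtain ⟨a, b, r, hr, hab⟩ :=
      exists_mul_pathProd_mul_eq_smul_vertex hK hp h0 (m := [e]) ⟨he, trivial⟩
    rw [pathProd, pathProd, edge_mul_vertex rfl] at hab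
    refine her (P.mem_of_smul_vertex_mem hr (?_ : r • vertex R E (E.range e) ∈ _))
    change _ = r • vertex R E (E.range e) at hab
    rw [← hab]
    refine TwoSidedIdeal.mul_mem_right _ _ _ (TwoSidedIdeal.mul_mem_left _ _ _ ?_)
    have := TwoSidedIdeal.sub_mem _ (hxe e he)
      (TwoSidedIdeal.mul_mem_right _ _ (edge R E e) hxp)
    rwa [sub_mul, sub_sub_cancel, mul_assoc, gap_mul_edge_of_notMem heF he] at this
  have hfin : (E.emittedOutside P.H w).Finite := F.finite_toSet.subset hsub
  have hgap := gap_sub_gap_mem (idealOfPair R P) w (F := F) (F' := hfin.toFinset)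
    (fun e he => hsub e ((Set.Finite.mem_toFinset _).1 he))
    (fun e he he' => P.vertex_mem_idealOfPair <| by
      by_contra hr
      exact he' ((Set.Finite.mem_toFinset _).2 ⟨hF e he, hr⟩))
  have hxp' : x - p * gap R E w hfin.toFinset ∈ idealOfPair R P := by
    have := TwoSidedIdeal.sub_mem _ hxp (TwoSidedIdeal.mul_mem_left _ p _ hgap)
    rwa [mul_sub, sub_sub, add_sub_cancel] at this
  -- If `w` is regular, the gap and hence `x` lie in the ideal. If `w` is a breaking vertex outside
  -- `S`, the gap is the reduced element. With no outside edges, the gap is `w` itself.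
  by_cases hne : (E.emittedOutside P.H w).Nonempty
  · by_cases hreg : (E.emitted w).Finite ∨ w ∈ P.S
    · refine absurd ?_ hxJ
      have := TwoSidedIdeal.add_mem _ hxp'
        (TwoSidedIdeal.mul_mem_left _ p _ (P.gap_mem_idealOfPair ⟨hne, hfin, hreg⟩))
      rwa [sub_add_cancel] at this
    · rw [not_or] at hreg
      obtain ⟨a, r, hr, har⟩ := exists_mul_gap_eq_smul_gap P.hereditary hw
        (fun e he => ((Set.Finite.mem_toFinset _).1 he).1)
        (fun e he => (Set.Finite.mem_toFinset hfin).2 he) hp h0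
      refine ⟨a, vertex R E w, r, gap R E w hfin.toFinset, hr,
        Or.inr ⟨w, ⟨hw, hreg.1, hne, hfin⟩, hreg.2, rfl⟩, ?_⟩
      rw [mul_assoc, hxw, ← har, ← mul_sub]
      exact TwoSidedIdeal.mul_mem_left _ _ _ hxp'
  · have he : hfin.toFinset = ∅ := by
      rw [Set.Finite.toFinset_eq_empty]
      exact Set.not_nonempty_iff_eq_empty.1 hne
    rw [he, gap_empty, mul_vertex_of_mem_pathSpan hp] at hxp'
    exact exists_reduced_of_sub_mem hK P hw hp h0 hxp'

/-- If some xe is outside the ideal, it has shorter ghost paths and induction applies. Otherwise all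
xee* vanish modulo the ideal, so x agrees with its product with a gap, and the gap kills every term
ending in a ghost edge. -/
theorem exists_reduced_of_mem_ghostFiltration [Countable A] [Nontrivial R] (hK : E.ConditionK)
    (P : E.AdmissiblePair) (n : ℕ) {w : V} {x : LeavittPathAlgebra R E}
    (hx : x ∈ ghostFiltration R E n w) (hxJ : x ∉ idealOfPair R P) :
    ∃ (a b : LeavittPathAlgebra R E) (r : R) (q : LeavittPathAlgebra R E),
      r ≠ 0 ∧ IsReducedElement P q ∧ a * x * b - r • q ∈ idealOfPair R P := by
  induction n generalizing w x with
  | zero =>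
    refine exists_reduced_of_sub_mem hK P
      (notMem_of_mul_vertex (mul_vertex_of_mem_ghostFiltration hx) hxJ) hx ?_ ?_
    · rintro rfl
      exact hxJ (TwoSidedIdeal.zero_mem _)
    · rw [sub_self]
      exact TwoSidedIdeal.zero_mem _
  | succ n ih =>
    obtain ⟨p, hp, F, y, hFy, hxsum⟩ := exists_decomposition_of_mem_ghostFiltration_succ hx
    have hxw := mul_vertex_of_mem_ghostFiltration hx
    by_cases hred : ∃ e, E.source e = w ∧ x * edge R E e ∉ idealOfPair R P
    · obtain ⟨e, he, hxe⟩ := hred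
      have hmem : x * edge R E e ∈ ghostFiltration R E n (E.range e) := by
        rw [hxsum, add_mul, Finset.sum_mul]
        refine Submodule.add_mem _
          (pathSpan_le_ghostFiltration _ _ (mul_edge_mem_pathSpan hp he))
          (Submodule.sum_mem _ fun f hf => ?_)
        rw [mul_assoc]
        by_cases hfe : f = e
        · subst hfe
          rw [ghost_mul_edge_self, mul_vertex_of_mem_ghostFiltration (hFy f hf).2]
          exact (hFy f hf).2
        · rw [ghost_mul_edge_of_ne hfe, mul_zero]
          exact Submodule.zero_mem _
      obtain ⟨a, b, r, q, hr, hq, h⟩ := ih hmem hxe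
      refine ⟨a, edge R E e * b, r, q, hr, hq, ?_⟩
      simpa only [mul_assoc] using h
    · simp only [not_exists, not_and, not_not] at hred
      have hF : ∀ e ∈ F, E.source e = w := fun e he => (hFy e he).1
      refine exists_reduced_of_mul_gap hK P hF hp hxw hxJ hred ?_
      have hxg : x * gap R E w F = p * gap R E w F := by
        conv_lhs => rw [hxsum]
        rw [add_mul, Finset.sum_mul, Finset.sum_eq_zero, add_zero]
        intro e he
        rw [mul_assoc, ghost_mul_gap he (hF e he), mul_zero]
      rw [← hxg, gap, mul_sub, hxw, sub_sub_cancel, Finset.mul_sum]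
      refine sum_mem_ideal _ _ fun e he => ?_
      rw [← mul_assoc]
      exact TwoSidedIdeal.mul_mem_right _ _ _ (hred e (hF e he))

/-! ### Basic ideals under Condition (K) -/

/-- The admissible pair of an ideal. -/
def admissiblePair (I : TwoSidedIdeal (LeavittPathAlgebra R E)) : E.AdmissiblePair where
  H := {v | vertex R E v ∈ I}
  S := {v | ∃ hv : v ∈ E.breaking {v | vertex R E v ∈ I}, breakingElement R E _ v hv ∈ I}
  hereditary e he := by
    rw [Set.mem_ofPred_eq] at he ⊢
    rw [← ghost_mul_edge_self, ← ghost_mul_vertex rfl]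
    exact I.mul_mem_right _ _ (I.mul_mem_left _ _ he)
  saturated v hne hfin h := by
    rw [Set.mem_ofPred_eq, (isLeavittFamily R E).vertex_eq_sum v hne hfin]
    exact sum_mem_ideal I _ fun e he =>
      I.mul_mem_right _ _ (edge_mem_of_range_mem I (h e ((Set.Finite.mem_toFinset _).1 he)))
  subset_breaking _ hv := hv.1

theorem idealOfPair_admissiblePair_le (I : TwoSidedIdeal (LeavittPathAlgebra R E)) :
    idealOfPair R (admissiblePair I) ≤ I := by
  refine TwoSidedIdeal.span_le.2 ?_
  rintro _ (⟨v, hv, rfl⟩ | ⟨v, hv, rfl⟩)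
  · exact hv
  · exact hv.2

theorem idealOfPair_admissiblePair [Countable A] [Nontrivial R] (hK : E.ConditionK)
    {I : TwoSidedIdeal (LeavittPathAlgebra R E)} (hI : IsBasicIdeal I) :
    idealOfPair R (admissiblePair I) = I := by
  refine le_antisymm (idealOfPair_admissiblePair_le I) fun x hx => ?_
  change x ∈ idealOfPair R (admissiblePair I)
  by_contra hxJ
  -- Sums of vertices are local units, so some xw stays outside the smaller ideal.
  obtain ⟨w, hw⟩ : ∃ w, x * vertex R E w ∉ idealOfPair R (admissiblePair I) := by
    by_contra! h
    obtain ⟨W, hW⟩ := exists_mul_sum_vertex x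
    rw [← hW, Finset.mul_sum] at hxJ
    exact hxJ (sum_mem_ideal _ _ fun w _ => h w)
  obtain ⟨n, hn⟩ := exists_mul_vertex_mem_ghostFiltration x w
  obtain ⟨a, b, r, q, hr, hq, h⟩ := exists_reduced_of_mem_ghostFiltration hK _ n hn hw
  have hxI : a * (x * vertex R E w) * b ∈ I :=
    I.mul_mem_right _ _ (I.mul_mem_left _ _ (I.mul_mem_right _ _ hx))
  have hqI : r • q ∈ I := by
    have := I.sub_mem hxI (idealOfPair_admissiblePair_le I h)
    rwa [sub_sub_cancel] at this
  rcases hq with ⟨u, hu, rfl⟩ | ⟨u, hu, huS, rfl⟩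
  · exact hu (hI.1 r u hr hqI)
  · exact huS ⟨hu, hI.2 r u _ hr (fun e he => ((Set.Finite.mem_toFinset _).1 he).1) hqI⟩

end LeavittPathAlgebra

/-! ### Necessity of Condition (K), and the theorem -/

open LeavittPathAlgebra in
theorem DirectedGraph.conditionK_of_basic_graded {R V A : Type*} [CommRing R] [Nontrivial R]
    {E : DirectedGraph V A}
    (h : ∀ I : TwoSidedIdeal (LeavittPathAlgebra R E), IsBasicIdeal I → IsGradedIdeal I) :
    E.ConditionK := by
  by_contra hK
  obtain ⟨u, e₀, l₀, h₀, huniq⟩ := E.exists_unique_firstReturn_of_not_conditionK hK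
  exact vertex_notMem_ker h₀ huniq R (vertex_mem_of_sub_mem
    (h _ (BranchingSystem.isBasicIdeal_ker _)) (List.cons_ne_nil _ _)
    (vertex_sub_pathProd_mem_ker h₀ huniq R))

theorem theorem3p18 (R : Type*) {V A : Type*} [CommRing R] [Nontrivial R] [Countable V] [Countable A]
    (E : DirectedGraph V A) :
    (E.ConditionK ↔
      ∀ I : TwoSidedIdeal (LeavittPathAlgebra R E),
        LeavittPathAlgebra.IsBasicIdeal I → LeavittPathAlgebra.IsGradedIdeal I) ∧
    (E.ConditionK →
      Set.BijOn (fun P : E.AdmissiblePair => LeavittPathAlgebra.idealOfPair R P) Set.univ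
        {I : TwoSidedIdeal (LeavittPathAlgebra R E) | LeavittPathAlgebra.IsBasicIdeal I}) := by
  refine ⟨⟨fun hK I hI => ?_, DirectedGraph.conditionK_of_basic_graded⟩, fun hK => ⟨?_, ?_, ?_⟩⟩
  · rw [← LeavittPathAlgebra.idealOfPair_admissiblePair hK hI]
    exact LeavittPathAlgebra.isGradedIdeal_idealOfPair _
  · exact fun P _ => P.isBasicIdeal_idealOfPair
  · exact DirectedGraph.AdmissiblePair.idealOfPair_injective.injOn
  · exact fun I hI => ⟨LeavittPathAlgebra.admissiblePair I, trivial,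
      LeavittPathAlgebra.idealOfPair_admissiblePair hK hI⟩
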